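/- Let $k$ be a commutative ring, $A$ an associative unital $k$-algebra and $C$ an $A$-coring, i.e. an $A$-bimodule (on which $k$ acts centrally) with a coassociative and counital comultiplication $\Delta:C\to C\otimes_A C$ and counit $\epsilon:C\to A$ that are bimodule maps. Let $\mathcal M^C$ and ${}^C\mathcal M$ be the categories of right and of left $C$-comodules, and let $\mathcal M^C_f$ and ${}^C\mathcal M_f$ be their full subcategories of finitely generated objects (an object is finitely generated if, whenever it is the union of a nonempty directed family of subobjects, it is equal to one of them). Suppose that $C$ has a duality, that is: ${}_AC$ and $C_A$ are flat; $\mathcal M^C$ and ${}^C\mathcal M$ are locally noetherian (have a family of noetherian generators); the dual modules ${}_A(M^*)$, $M^*=\operatorname{Hom}_A(M,A)$, and $({}^*N)_A$, ${}^*N=\operatorname{Hom}_A(N,A)$, are finitely generated for all $M\in\mathcal M^C_f$ and $N\in{}^C\mathcal M_f$; and the functors $(-)^*:\mathcal M^C_f\rightleftarrows{}^C\mathcal M_f:{}^*(-)$ form a contravariant equivalence with the evaluation maps $M\to{}^*(M^*)$ and $N\to({}^*N)^*$ as its units. Here the coaction of $M^*$ is the one for which the image of $\lambda(f)$ under the canonical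 map $C\otimes_A M^*\to\operatorname{Hom}_A(M,C)$ is $(f\otimes_A C)\rho_M$, and symmetrically for ${}^*N$. Let $M$ be a right $C$-comodule such that $M_A$ is flat. For a left comodule $N$, let $M\square_C N$ be the kernel of $\rho_M\otimes_A N-M\otimes_A\lambda_N:M\otimes_A N\to M\otimes_A C\otimes_A N$. Call $M$ coflat (resp. faithfully coflat) if the functor $M\square_C-:{}^C\mathcal M\to\mathcal M_k$ to $k$-modules is exact (resp. exact and faithful). Then the following three statements are equivalent: (1) $M$ is coflat; (2) the contravariant functor $\operatorname{Hom}_C(-,M)_f:\mathcal M^C_f\to\mathcal M_k$ is exact; (3) $M$ is an injective object of $\mathcal M^C$. Likewise, the following three statements are equivalent: (1') $M$ is faithfully coflat; (2') $\operatorname{Hom}_C(-,M)_f$ is faithfully exact, i.e. exact and faithful; (3') $M$ is an injective cogenerator of $\mathcal M^C$. -/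

import Mathlib

open CategoryTheory MulOpposite
open scoped TensorProduct

universe u

/-! Throughout, `A` is an algebra over a commutative ring `k`; a left `A`-module is a
`Module A`, a right `A`-module is a `Module Aᵐᵒᵖ`, and the `k`-module structures are
the ones induced by `k → A` (scalar towers), so that `k` acts centrally on bimodules. -/

noncomputable section

namespace CoringTheory

/-! ### The tensor product of a right module and a left module -/

section Tensor

variable (k A : Type u) [CommRing k] [Ring A]
variable (M : Type u) [AddCommGroup M] [Module k M] [Module Aᵐᵒᵖ M]
variable (N : Type u) [AddCommGroup N] [Module k N] [Module A N]

/-- The relations `(m a) ⊗ n - m ⊗ (a n)` in `M ⊗[k] N`. -/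
def balancedRel : Submodule k (M ⊗[k] N) :=
  Submodule.span k {x | ∃ (m : M) (a : A) (n : N), x = (op a • m) ⊗ₜ[k] n - m ⊗ₜ[k] (a • n)}

/-- The tensor product `M ⊗_A N` of a right `A`-module and a left `A`-module. -/
def BTensor : Type u := (M ⊗[k] N) ⧸ balancedRel k A M N

instance : AddCommGroup (BTensor k A M N) :=
  inferInstanceAs (AddCommGroup ((M ⊗[k] N) ⧸ balancedRel k A M N))

instance : Module k (BTensor k A M N) :=
  inferInstanceAs (Module k ((M ⊗[k] N) ⧸ balancedRel k A M N))

namespace BTensor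

/-- The canonical bilinear map `(m, n) ↦ m ⊗ n`. -/
def mk : M →ₗ[k] N →ₗ[k] BTensor k A M N :=
  (TensorProduct.mk k M N).compr₂ (balancedRel k A M N).mkQ

variable {M N}

/-- The elementary tensor `m ⊗ n` in `M ⊗_A N`. -/
abbrev tmul (m : M) (n : N) : BTensor k A M N := mk k A M N m n

theorem op_smul_tmul (m : M) (a : A) (n : N) :
    tmul k A (op a • m) n = tmul k A m (a • n) := by
  refine (Submodule.Quotient.eq _).2 (Submodule.subset_span ⟨m, a, n, rfl⟩)

variable {k A}

@[simp]
theorem add_tmul (m m' : M) (n : N) : tmul k A (m + m') n = tmul k A m n + tmul k A m' n := by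
  simp [tmul]

@[simp]
theorem tmul_add (m : M) (n n' : N) : tmul k A m (n + n') = tmul k A m n + tmul k A m n' := by
  simp [tmul]

@[simp]
theorem base_smul_tmul (r : k) (m : M) (n : N) : tmul k A (r • m) n = r • tmul k A m n := by
  simp [tmul]

@[simp]
theorem tmul_base_smul (r : k) (m : M) (n : N) : tmul k A m (r • n) = r • tmul k A m n := by
  simp [tmul]

@[simp]
theorem zero_tmul (n : N) : tmul k A (0 : M) n = 0 := by
  simp [tmul]

@[simp]
theorem tmul_zero (m : M) : tmul k A m (0 : N) = 0 := by
  simp [tmul]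

@[elab_as_elim]
theorem induction_on {p : BTensor k A M N → Prop} (x : BTensor k A M N)
    (zero : p 0) (tmul : ∀ m n, p (tmul k A m n))
    (add : ∀ x y, p x → p y → p (x + y)) : p x := by
  obtain ⟨y, rfl⟩ := (balancedRel k A M N).mkQ_surjective x
  induction y with
  | zero => exact zero
  | tmul m n => exact tmul m n
  | add a b ha hb => rw [map_add]; exact add _ _ ha hb

variable {P : Type u} [AddCommGroup P] [Module k P]

/-- The universal property: balanced bilinear maps factor through `M ⊗_A N`. -/
def lift (f : M →ₗ[k] N →ₗ[k] P) (hf : ∀ (m : M) (a : A) (n : N), f (op a • m) n = f m (a • n)) :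
    BTensor k A M N →ₗ[k] P :=
  (balancedRel k A M N).liftQ (TensorProduct.lift f) (by
    refine Submodule.span_le.2 ?_
    rintro _ ⟨m, a, n, rfl⟩
    simp [hf])

@[simp]
theorem lift_tmul (f : M →ₗ[k] N →ₗ[k] P) (hf : ∀ (m : M) (a : A) (n : N), f (op a • m) n = f m (a • n))
    (m : M) (n : N) : lift f hf (tmul k A m n) = f m n := rfl

theorem hom_ext {f g : BTensor k A M N →ₗ[k] P}
    (h : ∀ m n, f (tmul k A m n) = g (tmul k A m n)) : f = g := by
  ext x
  induction x using induction_on with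
  | zero => simp
  | tmul m n => exact h m n
  | add x y hx hy => rw [map_add, map_add, hx, hy]

section Map

variable [Algebra k A] [IsScalarTower k Aᵐᵒᵖ M] [IsScalarTower k A N]
variable {M' : Type u} [AddCommGroup M'] [Module k M'] [Module Aᵐᵒᵖ M'] [IsScalarTower k Aᵐᵒᵖ M']
variable {N' : Type u} [AddCommGroup N'] [Module k N'] [Module A N'] [IsScalarTower k A N']
variable {M'' : Type u} [AddCommGroup M''] [Module k M''] [Module Aᵐᵒᵖ M'']
  [IsScalarTower k Aᵐᵒᵖ M'']
variable {N'' : Type u} [AddCommGroup N''] [Module k N''] [Module A N''] [IsScalarTower k A N'']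

variable (k) in
/-- The map `f ⊗_A g`. -/
def map (f : M →ₗ[Aᵐᵒᵖ] M') (g : N →ₗ[A] N') : BTensor k A M N →ₗ[k] BTensor k A M' N' :=
  lift ((mk k A M' N').compl₁₂ (f.restrictScalars k) (g.restrictScalars k)) (by
    intro m a n
    simpa using op_smul_tmul k A (f m) a (g n))

@[simp]
theorem map_tmul (f : M →ₗ[Aᵐᵒᵖ] M') (g : N →ₗ[A] N') (m : M) (n : N) :
    map k f g (tmul k A m n) = tmul k A (f m) (g n) := rfl

theorem map_id : map k (LinearMap.id : M →ₗ[Aᵐᵒᵖ] M) (LinearMap.id : N →ₗ[A] N) =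
    LinearMap.id :=
  hom_ext fun _ _ => rfl

theorem map_map (f : M →ₗ[Aᵐᵒᵖ] M') (f' : M' →ₗ[Aᵐᵒᵖ] M'') (g : N →ₗ[A] N')
    (g' : N' →ₗ[A] N'') (x : BTensor k A M N) :
    map k f' g' (map k f g x) = map k (f' ∘ₗ f) (g' ∘ₗ g) x :=
  LinearMap.congr_fun (hom_ext (f := map k f' g' ∘ₗ map k f g)
    (g := map k (f' ∘ₗ f) (g' ∘ₗ g)) fun _ _ => rfl) x

theorem map_add_left (f f' : M →ₗ[Aᵐᵒᵖ] M') (g : N →ₗ[A] N') :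
    map k (f + f') g = map k f g + map k f' g :=
  hom_ext fun m n => by simp

theorem map_add_right (f : M →ₗ[Aᵐᵒᵖ] M') (g g' : N →ₗ[A] N') :
    map k f (g + g') = map k f g + map k f g' :=
  hom_ext fun m n => by simp

theorem map_smul_left (r : k) (f : M →ₗ[Aᵐᵒᵖ] M') (g : N →ₗ[A] N') :
    map k (r • f) g = r • map k f g :=
  hom_ext fun m n => by simp

theorem map_smul_right (r : k) (f : M →ₗ[Aᵐᵒᵖ] M') (g : N →ₗ[A] N') :
    map k f (r • g) = r • map k f g :=
  hom_ext fun m n => by simp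

theorem map_zero_left (g : N →ₗ[A] N') : map k (0 : M →ₗ[Aᵐᵒᵖ] M') g = 0 :=
  hom_ext fun m n => by simp

theorem map_zero_right (f : M →ₗ[Aᵐᵒᵖ] M') : map k f (0 : N →ₗ[A] N') = 0 :=
  hom_ext fun m n => by simp

/-- For a left linear form `g` on `N`, the map `M ⊗_A N → M`, `m ⊗ n ↦ m g(n)`. -/
def contractRight (g : N →ₗ[A] A) : BTensor k A M N →ₗ[k] M :=
  lift (LinearMap.mk₂ k (fun m n => op (g n) • m)
    (fun m m' n => smul_add _ _ _)
    (fun r m n => by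
      rw [← IsScalarTower.algebraMap_smul Aᵐᵒᵖ r m, smul_smul,
        ← IsScalarTower.algebraMap_smul Aᵐᵒᵖ r (op (g n) • m), smul_smul,
        Algebra.commutes])
    (fun m n n' => by rw [_root_.map_add, MulOpposite.op_add, add_smul])
    (fun r m n => by
      rw [← IsScalarTower.algebraMap_smul A r n, map_smul, smul_eq_mul, MulOpposite.op_mul,
        ← IsScalarTower.algebraMap_smul Aᵐᵒᵖ r (op (g n) • m), smul_smul,
        Algebra.commutes]
      rfl)) (by
    intro m a n
    simp [smul_smul])

/-- For a right linear form `f` on `M`, the map `M ⊗_A N → N`, `m ⊗ n ↦ f(m) n`. -/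
def contractLeft (f : M →ₗ[Aᵐᵒᵖ] A) : BTensor k A M N →ₗ[k] N :=
  lift (LinearMap.mk₂ k (fun m n => f m • n)
    (fun m m' n => by rw [map_add, add_smul])
    (fun r m n => by
      rw [← IsScalarTower.algebraMap_smul Aᵐᵒᵖ r m, map_smul,
        ← IsScalarTower.algebraMap_smul A r (f m • n), smul_smul,
        Algebra.commutes]
      rfl)
    (fun m n n' => smul_add _ _ _)
    (fun r m n => by
      rw [← IsScalarTower.algebraMap_smul A r n, smul_smul,
        ← IsScalarTower.algebraMap_smul A r (f m • n), smul_smul,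
        Algebra.commutes])) (by
    intro m a n
    simp [smul_smul])

@[simp]
theorem contractRight_tmul (g : N →ₗ[A] A) (m : M) (n : N) :
    contractRight g (tmul k A m n) = op (g n) • m := rfl

@[simp]
theorem contractLeft_tmul (f : M →ₗ[Aᵐᵒᵖ] A) (m : M) (n : N) :
    contractLeft f (tmul k A m n) = f m • n := rfl

end Map

/-! If `M` is a bimodule then `M ⊗_A N` is a left module, and if `N` is a bimodule then
`M ⊗_A N` is a right module. -/

section Actions

variable [Algebra k A] [IsScalarTower k Aᵐᵒᵖ M] [IsScalarTower k A N]

instance leftModule [Module A M] [SMulCommClass A Aᵐᵒᵖ M] : Module A (BTensor k A M N) where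
  smul a x := map k (DistribSMul.toLinearMap Aᵐᵒᵖ M a) LinearMap.id x
  one_smul x := by
    induction x using induction_on with
    | zero => exact map_zero _
    | tmul m n => exact congrArg (fun z => tmul k A z n) (one_smul A m)
    | add x y hx hy => exact (map_add _ _ _).trans (congrArg₂ (· + ·) hx hy)
  mul_smul a b x := by
    induction x using induction_on with
    | zero =>
      exact (map_zero _).trans ((congrArg _ (map_zero _)).trans (map_zero _)).symm
    | tmul m n => exact congrArg (fun z => tmul k A z n) (mul_smul a b m)
    | add x y hx hy =>
      exact (map_add _ _ _).trans ((congrArg₂ (· + ·) hx hy).trans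
        ((congrArg _ (map_add _ _ _)).trans (map_add _ _ _)).symm)
  smul_zero a := map_zero _
  smul_add a x y := map_add _ _ _
  add_smul a b x := by
    have h : DistribSMul.toLinearMap Aᵐᵒᵖ M (a + b) =
        DistribSMul.toLinearMap Aᵐᵒᵖ M a + DistribSMul.toLinearMap Aᵐᵒᵖ M b := by
      ext m; exact add_smul a b m
    change map k (DistribSMul.toLinearMap Aᵐᵒᵖ M (a + b)) LinearMap.id x = _
    rw [h, map_add_left]; rfl
  zero_smul x := by
    have h : DistribSMul.toLinearMap Aᵐᵒᵖ M (0 : A) = 0 := by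
      ext m; exact zero_smul A m
    change map k (DistribSMul.toLinearMap Aᵐᵒᵖ M (0 : A)) LinearMap.id x = _
    rw [h, map_zero_left]; rfl

@[simp]
theorem smul_tmul [Module A M] [SMulCommClass A Aᵐᵒᵖ M] (a : A) (m : M) (n : N) :
    a • tmul k A m n = tmul k A (a • m) n := rfl

instance leftTower [Module A M] [SMulCommClass A Aᵐᵒᵖ M] [IsScalarTower k A M] :
    IsScalarTower k A (BTensor k A M N) where
  smul_assoc r a x := by
    induction x using induction_on with
    | zero => simp
    | tmul m n => simp
    | add x y hx hy => simp only [smul_add, hx, hy]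

instance smulCommClass_bimodule [Module Aᵐᵒᵖ N] [SMulCommClass A Aᵐᵒᵖ N] :
    SMulCommClass Aᵐᵒᵖ A N := SMulCommClass.symm _ _ _

instance rightModule [Module Aᵐᵒᵖ N] [SMulCommClass A Aᵐᵒᵖ N] :
    Module Aᵐᵒᵖ (BTensor k A M N) where
  smul a x := map k LinearMap.id (DistribSMul.toLinearMap A N a) x
  one_smul x := by
    induction x using induction_on with
    | zero => exact map_zero _
    | tmul m n => exact congrArg (fun z => tmul k A m z) (one_smul Aᵐᵒᵖ n)
    | add x y hx hy => exact (map_add _ _ _).trans (congrArg₂ (· + ·) hx hy)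
  mul_smul a b x := by
    induction x using induction_on with
    | zero =>
      exact (map_zero _).trans ((congrArg _ (map_zero _)).trans (map_zero _)).symm
    | tmul m n => exact congrArg (fun z => tmul k A m z) (mul_smul a b n)
    | add x y hx hy =>
      exact (map_add _ _ _).trans ((congrArg₂ (· + ·) hx hy).trans
        ((congrArg _ (map_add _ _ _)).trans (map_add _ _ _)).symm)
  smul_zero a := map_zero _
  smul_add a x y := map_add _ _ _
  add_smul a b x := by
    have h : DistribSMul.toLinearMap A N (a + b) =
        DistribSMul.toLinearMap A N a + DistribSMul.toLinearMap A N b := by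
      ext m; exact add_smul a b m
    change map k LinearMap.id (DistribSMul.toLinearMap A N (a + b)) x = _
    rw [h, map_add_right]; rfl
  zero_smul x := by
    have h : DistribSMul.toLinearMap A N (0 : Aᵐᵒᵖ) = 0 := by
      ext m; exact zero_smul Aᵐᵒᵖ m
    change map k LinearMap.id (DistribSMul.toLinearMap A N (0 : Aᵐᵒᵖ)) x = _
    rw [h, map_zero_right]; rfl

@[simp]
theorem op_smul_tmul' [Module Aᵐᵒᵖ N] [SMulCommClass A Aᵐᵒᵖ N] (a : Aᵐᵒᵖ) (m : M) (n : N) :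
    a • tmul k A m n = tmul k A m (a • n) := rfl

instance rightTower [Module Aᵐᵒᵖ N] [SMulCommClass A Aᵐᵒᵖ N] [IsScalarTower k Aᵐᵒᵖ N] :
    IsScalarTower k Aᵐᵒᵖ (BTensor k A M N) where
  smul_assoc r a x := by
    induction x using induction_on with
    | zero => simp
    | tmul m n => simp
    | add x y hx hy => simp only [smul_add, hx, hy]

instance bimodule [Module A M] [SMulCommClass A Aᵐᵒᵖ M] [Module Aᵐᵒᵖ N]
    [SMulCommClass A Aᵐᵒᵖ N] : SMulCommClass A Aᵐᵒᵖ (BTensor k A M N) where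
  smul_comm a b x := by
    induction x using induction_on with
    | zero => simp
    | tmul m n => simp
    | add x y hx hy => simp only [smul_add, hx, hy]

end Actions

section Assoc

variable [Algebra k A] [IsScalarTower k Aᵐᵒᵖ M] [IsScalarTower k A N]
variable {C : Type u} [AddCommGroup C] [Module k C] [Module A C] [Module Aᵐᵒᵖ C]
  [SMulCommClass A Aᵐᵒᵖ C] [IsScalarTower k A C] [IsScalarTower k Aᵐᵒᵖ C]

/-- The canonical map `(M ⊗_A C) ⊗_A N → M ⊗_A (C ⊗_A N)`, `(m ⊗ c) ⊗ n ↦ m ⊗ (c ⊗ n)`. -/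
def assoc : BTensor k A (BTensor k A M C) N →ₗ[k] BTensor k A M (BTensor k A C N) :=
  lift (lift (LinearMap.mk₂ k (fun m c => mk k A M (BTensor k A C N) m ∘ₗ mk k A C N c)
      (fun m m' c => by ext n; simp)
      (fun r m c => by ext n; simp)
      (fun m c c' => by ext n; simp)
      (fun r m c => by ext n; simp))
      (fun m a c => by ext n; exact op_smul_tmul k A m a (tmul k A c n)))
    (fun x a n => by
      induction x using induction_on with
      | zero => simp
      | tmul m c => exact congrArg (tmul k A m) (op_smul_tmul k A c a n)
      | add x y hx hy => simp only [smul_add, map_add, LinearMap.add_apply, hx, hy])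

@[simp]
theorem assoc_tmul (m : M) (c : C) (n : N) :
    assoc (tmul k A (tmul k A m c) n) = tmul k A m (tmul k A c n) := rfl

end Assoc

end BTensor

end Tensor

/-! ### Flatness over a noncommutative ring -/

/-- The right `A`-module `M` is flat: `M ⊗_A -` preserves injective maps of left modules. -/
def RightFlat (k A : Type u) [CommRing k] [Ring A] [Algebra k A]
    (M : Type u) [AddCommGroup M] [Module k M] [Module Aᵐᵒᵖ M] [IsScalarTower k Aᵐᵒᵖ M] : Prop :=
  ∀ (P Q : Type u) [AddCommGroup P] [Module k P] [Module A P] [IsScalarTower k A P]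
    [AddCommGroup Q] [Module k Q] [Module A Q] [IsScalarTower k A Q] (f : P →ₗ[A] Q),
    Function.Injective f →
      Function.Injective (BTensor.map k (LinearMap.id : M →ₗ[Aᵐᵒᵖ] M) f)

/-- The left `A`-module `N` is flat: `- ⊗_A N` preserves injective maps of right modules. -/
def LeftFlat (k A : Type u) [CommRing k] [Ring A] [Algebra k A]
    (N : Type u) [AddCommGroup N] [Module k N] [Module A N] [IsScalarTower k A N] : Prop :=
  ∀ (P Q : Type u) [AddCommGroup P] [Module k P] [Module Aᵐᵒᵖ P] [IsScalarTower k Aᵐᵒᵖ P]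
    [AddCommGroup Q] [Module k Q] [Module Aᵐᵒᵖ Q] [IsScalarTower k Aᵐᵒᵖ Q] (f : P →ₗ[Aᵐᵒᵖ] Q),
    Function.Injective f →
      Function.Injective (BTensor.map k f (LinearMap.id : N →ₗ[A] N))

/-! ### Corings -/

/-- A homomorphism of `A`-bimodules. -/
structure BimoduleHom (A M N : Type u) [Ring A] [AddCommGroup M] [Module A M] [Module Aᵐᵒᵖ M]
    [AddCommGroup N] [Module A N] [Module Aᵐᵒᵖ N] where
  /-- the underlying left linear map -/
  left : M →ₗ[A] N
  map_op_smul : ∀ (a : Aᵐᵒᵖ) (m : M), left (a • m) = a • left m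

/-- The underlying right linear map of a bimodule homomorphism. -/
def BimoduleHom.right {A M N : Type u} [Ring A] [AddCommGroup M] [Module A M] [Module Aᵐᵒᵖ M]
    [AddCommGroup N] [Module A N] [Module Aᵐᵒᵖ N] (f : BimoduleHom A M N) : M →ₗ[Aᵐᵒᵖ] N where
  toFun := f.left
  map_add' := f.left.map_add
  map_smul' := f.map_op_smul

/-- An `A`-coring structure on the `A`-bimodule `C`. -/
class Coring (k A C : Type u) [CommRing k] [Ring A] [Algebra k A] [AddCommGroup C] [Module k C]
    [Module A C] [Module Aᵐᵒᵖ C] [SMulCommClass A Aᵐᵒᵖ C] [IsScalarTower k A C]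
    [IsScalarTower k Aᵐᵒᵖ C] where
  /-- the comultiplication `Δ` -/
  comul : BimoduleHom A C (BTensor k A C C)
  /-- the counit `ε` -/
  counit : BimoduleHom A C A
  coassoc : ∀ c : C,
    BTensor.assoc (BTensor.map k comul.right (LinearMap.id : C →ₗ[A] C) (comul.left c)) =
      BTensor.map k (LinearMap.id : C →ₗ[Aᵐᵒᵖ] C) comul.left (comul.left c)
  counit_left : ∀ c : C, BTensor.contractLeft counit.right (comul.left c) = c
  counit_right : ∀ c : C, BTensor.contractRight counit.left (comul.left c) = c

/-! ### Comodules -/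

section Comodules

variable (k A C : Type u) [CommRing k] [Ring A] [Algebra k A] [AddCommGroup C] [Module k C]
    [Module A C] [Module Aᵐᵒᵖ C] [SMulCommClass A Aᵐᵒᵖ C] [IsScalarTower k A C]
    [IsScalarTower k Aᵐᵒᵖ C] [Coring k A C]

/-- A right comodule over the `A`-coring `C`. -/
structure RightComod where
  /-- the underlying right `A`-module -/
  carrier : Type u
  [addCommGroup : AddCommGroup carrier]
  [moduleBase : Module k carrier]
  [module : Module Aᵐᵒᵖ carrier]
  [tower : IsScalarTower k Aᵐᵒᵖ carrier]
  /-- the coaction `ρ` -/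
  coact : carrier →ₗ[Aᵐᵒᵖ] BTensor k A carrier C
  coassoc : ∀ m : carrier,
    BTensor.assoc (BTensor.map k coact (LinearMap.id : C →ₗ[A] C) (coact m)) =
      BTensor.map k (LinearMap.id : carrier →ₗ[Aᵐᵒᵖ] carrier)
        (Coring.comul (k := k) (A := A) (C := C)).left (coact m)
  counit : ∀ m : carrier,
    BTensor.contractRight (Coring.counit (k := k) (A := A) (C := C)).left (coact m) = m

/-- A left comodule over the `A`-coring `C`. -/
structure LeftComod where
  /-- the underlying left `A`-module -/
  carrier : Type u
  [addCommGroup : AddCommGroup carrier]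
  [moduleBase : Module k carrier]
  [module : Module A carrier]
  [tower : IsScalarTower k A carrier]
  /-- the coaction `λ` -/
  coact : carrier →ₗ[A] BTensor k A C carrier
  coassoc : ∀ n : carrier,
    BTensor.map k (LinearMap.id : C →ₗ[Aᵐᵒᵖ] C) coact (coact n) =
      BTensor.assoc (BTensor.map k (Coring.comul (k := k) (A := A) (C := C)).right
        (LinearMap.id : carrier →ₗ[A] carrier) (coact n))
  counit : ∀ n : carrier,
    BTensor.contractLeft (Coring.counit (k := k) (A := A) (C := C)).right (coact n) = n

attribute [instance] RightComod.addCommGroup RightComod.moduleBase RightComod.module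
  RightComod.tower LeftComod.addCommGroup LeftComod.moduleBase LeftComod.module LeftComod.tower

variable {k A C}

namespace RightComod

/-- The `k`-module `Hom_C(M, N)` of comodule morphisms: right `A`-linear maps `f` with
`(f ⊗ C) ρ_M = ρ_N f`. -/
def homs (M N : RightComod k A C) : Submodule k (M.carrier →ₗ[Aᵐᵒᵖ] N.carrier) where
  carrier := {f | ∀ m, BTensor.map k f (LinearMap.id : C →ₗ[A] C) (M.coact m) = N.coact (f m)}
  zero_mem' m := by simp [BTensor.map_zero_left]
  add_mem' {f g} hf hg m := by
    rw [BTensor.map_add_left, LinearMap.add_apply, hf m, hg m, LinearMap.add_apply, map_add]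
  smul_mem' r f hf m := by
    rw [BTensor.map_smul_left, LinearMap.smul_apply, hf m, LinearMap.smul_apply,
      LinearMap.map_smul_of_tower]

/-- The category `M^C` of right comodules. -/
instance : Category.{u} (RightComod k A C) where
  Hom M N := homs M N
  id M := ⟨LinearMap.id, fun m => by rw [BTensor.map_id]; rfl⟩
  comp {L M N} f g := ⟨g.1 ∘ₗ f.1, fun m => by
    have h := BTensor.map_map (k := k) f.1 g.1 (LinearMap.id : C →ₗ[A] C) LinearMap.id (L.coact m)
    rw [LinearMap.id_comp] at h
    rw [← h, f.2 m, g.2 (f.1 m)]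
    rfl⟩

/-- The underlying linear map of a morphism of comodules. -/
def linearMap {M N : RightComod k A C} (f : M ⟶ N) : M.carrier →ₗ[Aᵐᵒᵖ] N.carrier :=
  Subtype.val f

instance : Preadditive (RightComod k A C) where
  homGroup M N := inferInstanceAs (AddCommGroup (homs M N))
  add_comp _ _ _ f f' g := Subtype.ext (LinearMap.comp_add f.1 f'.1 g.1)
  comp_add _ _ _ f g g' := Subtype.ext (LinearMap.add_comp f.1 g'.1 g.1)

instance : Linear k (RightComod k A C) where
  homModule M N := inferInstanceAs (Module k (homs M N))
  smul_comp _ _ _ r f g := Subtype.ext (LinearMap.ext fun m => g.1.map_smul_of_tower r (f.1 m))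
  comp_smul _ _ _ _ _ _ := rfl

end RightComod

namespace LeftComod

/-- The `k`-module of comodule morphisms: left `A`-linear maps `f` with
`(C ⊗ f) λ_M = λ_N f`. -/
def homs (M N : LeftComod k A C) : Submodule k (M.carrier →ₗ[A] N.carrier) where
  carrier := {f | ∀ m, BTensor.map k (LinearMap.id : C →ₗ[Aᵐᵒᵖ] C) f (M.coact m) = N.coact (f m)}
  zero_mem' m := by simp [BTensor.map_zero_right]
  add_mem' {f g} hf hg m := by
    rw [BTensor.map_add_right, LinearMap.add_apply, hf m, hg m, LinearMap.add_apply, map_add]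
  smul_mem' r f hf m := by
    rw [BTensor.map_smul_right, LinearMap.smul_apply, hf m, LinearMap.smul_apply,
      LinearMap.map_smul_of_tower]

/-- The category `^C M` of left comodules. -/
instance : Category.{u} (LeftComod k A C) where
  Hom M N := homs M N
  id M := ⟨LinearMap.id, fun m => by rw [BTensor.map_id]; rfl⟩
  comp {L M N} f g := ⟨g.1 ∘ₗ f.1, fun m => by
    have h := BTensor.map_map (k := k) (LinearMap.id : C →ₗ[Aᵐᵒᵖ] C) LinearMap.id f.1 g.1
      (L.coact m)
    rw [LinearMap.id_comp] at h
    rw [← h, f.2 m, g.2 (f.1 m)]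
    rfl⟩

/-- The underlying linear map of a morphism of comodules. -/
def linearMap {M N : LeftComod k A C} (f : M ⟶ N) : M.carrier →ₗ[A] N.carrier :=
  Subtype.val f

instance : Preadditive (LeftComod k A C) where
  homGroup M N := inferInstanceAs (AddCommGroup (homs M N))
  add_comp _ _ _ f f' g := Subtype.ext (LinearMap.comp_add f.1 f'.1 g.1)
  comp_add _ _ _ f g g' := Subtype.ext (LinearMap.add_comp f.1 g'.1 g.1)

end LeftComod

end Comodules

/-! ### Categorical notions -/

section Categorical

/-- An additive functor is exact if it preserves short exact sequences. -/
def IsExact {X Y : Type*} [Category* X] [Category* Y] [Preadditive X] [Preadditive Y]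
    (F : X ⥤ Y) [F.Additive] : Prop :=
  ∀ S : ShortComplex X, S.ShortExact → (S.map F).ShortExact

/-- A functor is faithfully exact if it is exact and faithful. -/
def IsFaithfullyExact {X Y : Type*} [Category* X] [Category* Y] [Preadditive X] [Preadditive Y]
    (F : X ⥤ Y) [F.Additive] : Prop :=
  IsExact F ∧ F.Faithful

/-- Finitely generated objects: if `M` is the union of a (nonempty) directed set of
subobjects, then one of these is `M`. -/
def finitelyGenerated (X : Type*) [Category* X] : ObjectProperty X := fun M =>
  ∀ s : Set (Subobject M), s.Nonempty → DirectedOn (· ≤ ·) s → IsLUB s ⊤ → ⊤ ∈ s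

/-- A category is locally noetherian if it has a (small) family of noetherian generators. -/
def IsLocallyNoetherian (X : Type (u + 1)) [Category.{u} X] : Prop :=
  ∃ (ι : Type u) (G : ι → X), (∀ i, IsNoetherianObject (G i)) ∧
    (ObjectProperty.ofObj G).IsSeparating

end Categorical

/-! ### Functors on comodules, and duality -/

section Main

variable (k A C : Type u) [CommRing k] [Ring A] [Algebra k A] [AddCommGroup C] [Module k C]
    [Module A C] [Module Aᵐᵒᵖ C] [SMulCommClass A Aᵐᵒᵖ C] [IsScalarTower k A C]
    [IsScalarTower k Aᵐᵒᵖ C] [Coring k A C]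

/-- The full subcategory `M^C_f` of finitely generated right comodules. -/
abbrev RightComodFg := (finitelyGenerated (RightComod k A C)).FullSubcategory

/-- The full subcategory `^C M_f` of finitely generated left comodules. -/
abbrev LeftComodFg := (finitelyGenerated (LeftComod k A C)).FullSubcategory

variable {k A C}

/-- The map `ω_{M,N} = ρ_M ⊗ N - M ⊗ λ_N : M ⊗_A N → M ⊗_A C ⊗_A N`. -/
def omega (M : RightComod k A C) (N : LeftComod k A C) :
    BTensor k A M.carrier N.carrier →ₗ[k]
      BTensor k A M.carrier (BTensor k A C N.carrier) :=
  BTensor.assoc ∘ₗ BTensor.map k M.coact LinearMap.id - BTensor.map k LinearMap.id N.coact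

theorem omega_naturality (M : RightComod k A C) {N N' : LeftComod k A C} (f : N ⟶ N')
    (x : BTensor k A M.carrier N.carrier) :
    omega M N' (BTensor.map k LinearMap.id (LeftComod.linearMap f) x) =
      BTensor.map k LinearMap.id
        ({ toFun := BTensor.map k LinearMap.id (LeftComod.linearMap f)
           map_add' := map_add _
           map_smul' := fun a y => by
            induction y using BTensor.induction_on with
            | zero => simp
            | tmul m n => simp
            | add y z hy hz => simp only [smul_add, map_add, hy, hz] } :
          BTensor k A C N.carrier →ₗ[A] BTensor k A C N'.carrier)
        (omega M N x) := by
  induction x using BTensor.induction_on with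
  | zero => simp
  | tmul m n =>
    simp only [omega, LinearMap.sub_apply, LinearMap.comp_apply, BTensor.map_tmul,
      LinearMap.id_apply, map_sub, LinearMap.coe_mk, AddHom.coe_mk]
    congr 1
    · generalize M.coact m = y
      induction y using BTensor.induction_on with
      | zero => simp
      | tmul m c => simp
      | add y z hy hz => simp only [BTensor.add_tmul, map_add, hy, hz]
    · exact congrArg _ (f.2 n).symm
  | add x y hx hy => simp only [map_add, hx, hy]

/-- The cotensor functor `M □_C - : ^C M → M_k`, where `M □_C N` is the kernel of `ω_{M,N}`. -/
def cotensor (M : RightComod k A C) : LeftComod k A C ⥤ ModuleCat.{u} k where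
  obj N := ModuleCat.of k (LinearMap.ker (omega M N))
  map {N N'} f := ModuleCat.ofHom
    ((BTensor.map k LinearMap.id (LeftComod.linearMap f)).restrict (by
      intro x hx
      rw [LinearMap.mem_ker] at hx ⊢
      rw [omega_naturality, hx, map_zero]))
  map_id N := by
    apply ModuleCat.hom_ext
    refine LinearMap.ext fun x => ?_
    exact Subtype.ext (LinearMap.congr_fun BTensor.map_id x.1)
  map_comp f g := by
    apply ModuleCat.hom_ext
    refine LinearMap.ext fun x => ?_
    exact Subtype.ext (BTensor.map_map (k := k) LinearMap.id LinearMap.id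
      (LeftComod.linearMap f) (LeftComod.linearMap g) x.1).symm

instance (M : RightComod k A C) : (cotensor M).Additive where
  map_add {N N' f g} := by
    apply ModuleCat.hom_ext
    refine LinearMap.ext fun x => ?_
    exact Subtype.ext (LinearMap.congr_fun (BTensor.map_add_right (k := k) LinearMap.id
      (LeftComod.linearMap f) (LeftComod.linearMap g)) x.1)

/-- `M` is coflat: `M □_C -` is exact. -/
def Coflat (M : RightComod k A C) : Prop := IsExact (cotensor M)

/-- `M` is faithfully coflat: `M □_C -` is exact and faithful. -/
def FaithfullyCoflat (M : RightComod k A C) : Prop := IsFaithfullyExact (cotensor M)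

/-- The contravariant functor `Hom_C(-, M)_f : M^C_f → M_k`. -/
def homFg (M : RightComod k A C) : (RightComodFg k A C)ᵒᵖ ⥤ ModuleCat.{u} k :=
  (finitelyGenerated (RightComod k A C)).ι.op ⋙ (linearYoneda k (RightComod k A C)).obj M

instance (M : RightComod k A C) : (homFg M).Additive :=
  inferInstanceAs (((finitelyGenerated (RightComod k A C)).ι.op ⋙
    (linearYoneda k (RightComod k A C)).obj M).Additive)

/-- The right dual `M^* = Hom_A(M, A)` of a right module, a left module by
`(a f)(m) = a f(m)`. -/
abbrev DualOfRight (A M : Type u) [Ring A] [AddCommGroup M] [Module Aᵐᵒᵖ M] : Type u :=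
  M →ₗ[Aᵐᵒᵖ] A

/-- The left dual `^*N = Hom_A(N, A)` of a left module, a right module by
`(f a)(n) = f(n) a`. -/
abbrev DualOfLeft (A N : Type u) [Ring A] [AddCommGroup N] [Module A N] : Type u :=
  N →ₗ[A] A

/-- Evaluation at `m`, a left linear form on `M^*`. -/
def evalRight {A M : Type u} [Ring A] [AddCommGroup M] [Module Aᵐᵒᵖ M] (m : M) :
    DualOfRight A M →ₗ[A] A where
  toFun f := f m
  map_add' _ _ := rfl
  map_smul' _ _ := rfl

/-- Evaluation at `n`, a right linear form on `^*N`. -/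
def evalLeft {A N : Type u} [Ring A] [AddCommGroup N] [Module A N] (n : N) :
    DualOfLeft A N →ₗ[Aᵐᵒᵖ] A where
  toFun f := f n
  map_add' _ _ := rfl
  map_smul' _ _ := rfl

/-- An identification `e` of (the module underlying) a left comodule `D` with `M^*` is
compatible with the coactions if, for `f ∈ M^*`, the image of `λ(f)` under the canonical map
`C ⊗_A M^* → Hom_A(M, C)`, `c ⊗ g ↦ (m ↦ c g(m))`, is
`(f ⊗ C) ρ_M : M → A ⊗_A C = C`. -/
def IsDualOfRight (M : RightComod k A C) (D : LeftComod k A C)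
    (e : D.carrier ≃ₗ[A] DualOfRight A M.carrier) : Prop :=
  ∀ (d : D.carrier) (m : M.carrier),
    BTensor.contractRight (evalRight m ∘ₗ e.toLinearMap) (D.coact d) =
      BTensor.contractLeft (e d) (M.coact m)

/-- An identification `e` of (the module underlying) a right comodule `D` with `^*N` is
compatible with the coactions if, for `f ∈ ^*N`, the image of `ρ(f)` under the canonical map
`^*N ⊗_A C → Hom_A(N, C)`, `g ⊗ c ↦ (n ↦ g(n) c)`, is
`(C ⊗ f) λ_N : N → C ⊗_A A = C`. -/
def IsDualOfLeft (N : LeftComod k A C) (D : RightComod k A C)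
    (e : D.carrier ≃ₗ[Aᵐᵒᵖ] DualOfLeft A N.carrier) : Prop :=
  ∀ (d : D.carrier) (n : N.carrier),
    BTensor.contractLeft (evalLeft n ∘ₗ e.toLinearMap) (D.coact d) =
      BTensor.contractRight (e d) (N.coact n)

variable (k A C) in
/-- The duality `(-)^* : M^C_f ⇄ ^C M_f : ^*(-)`: a contravariant equivalence whose functors
are the `A`-duals with their natural comodule structures, and whose units
`M → ^*(M^*)` and `N → (^*N)^*` are the evaluation maps. -/
structure Duality where
  /-- the contravariant equivalence -/
  equiv : (RightComodFg k A C)ᵒᵖ ≌ LeftComodFg k A C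
  /-- the functor is `(-)^*` -/
  dualRight : ∀ M : RightComodFg k A C,
    (equiv.functor.obj (Opposite.op M)).obj.carrier ≃ₗ[A] DualOfRight A M.obj.carrier
  dualRight_coact : ∀ M, IsDualOfRight M.obj (equiv.functor.obj (Opposite.op M)).obj (dualRight M)
  dualRight_naturality : ∀ {M M' : RightComodFg k A C} (h : M ⟶ M') d,
    dualRight M (LeftComod.linearMap (equiv.functor.map h.op).hom d) =
      dualRight M' d ∘ₗ RightComod.linearMap h.hom
  /-- the inverse functor is `^*(-)` -/
  dualLeft : ∀ N : LeftComodFg k A C,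
    (equiv.inverse.obj N).unop.obj.carrier ≃ₗ[Aᵐᵒᵖ] DualOfLeft A N.obj.carrier
  dualLeft_coact : ∀ N, IsDualOfLeft N.obj (equiv.inverse.obj N).unop.obj (dualLeft N)
  dualLeft_naturality : ∀ {N N' : LeftComodFg k A C} (h : N ⟶ N') d,
    dualLeft N (RightComod.linearMap (equiv.inverse.map h).unop.hom d) =
      dualLeft N' d ∘ₗ LeftComod.linearMap h.hom
  unit_eval : ∀ (M : RightComodFg k A C) (m : M.obj.carrier) d,
    dualLeft (equiv.functor.obj (Opposite.op M))
        (RightComod.linearMap (equiv.unitIso.inv.app (Opposite.op M)).unop.hom m) d =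
      dualRight M d m
  counit_eval : ∀ (N : LeftComodFg k A C) (n : N.obj.carrier) d,
    dualRight (equiv.inverse.obj N).unop
        (LeftComod.linearMap (equiv.counitIso.inv.app N).hom n) d =
      dualLeft N d n

variable (k A C) in
/-- The coring `C` has a duality. -/
structure HasDuality : Prop where
  leftFlat : LeftFlat k A C
  rightFlat : RightFlat k A C
  locallyNoetherian_right : IsLocallyNoetherian (RightComod k A C)
  locallyNoetherian_left : IsLocallyNoetherian (LeftComod k A C)
  finite_dualRight : ∀ M : RightComodFg k A C, Module.Finite A (DualOfRight A M.obj.carrier)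
  finite_dualLeft : ∀ N : LeftComodFg k A C, Module.Finite Aᵐᵒᵖ (DualOfLeft A N.obj.carrier)
  duality : Nonempty (Duality k A C)

end Main

end CoringTheory

end

/-! On finitely generated comodules the duality turns the cotensor product into a Hom. For `N`
finitely generated and `D = ^*N`, contraction gives a map `M ⊗_A N → Hom_A(D, M)`. It is bijective
because `M` is flat, `D` is finitely presented and `N` is the dual of `D`. Contracting `ω(x)` by `d
∈ D` measures the failure at `d` of the image of `x` to be colinear, so the map restricts to `M □_C
N ≅ Hom_C(^*N, M)`, naturally in `N` (`tensorToHom_bijOn`, `Duality.tensorToHom_map`). Hence, on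
finitely generated objects, `M □_C -` sends epimorphisms to surjections exactly when morphisms to
`M` extend along monomorphisms, and faithfulness transfers in the same way.

Finite generation of `D` is assumed; finite presentation has to be proved (`RightComod.ker_fg`). A
surjection `V → D` induces `V ⊗_A C → D ⊗_A C` of cofree comodules. A noetherian subcomodule of `V
⊗_A C` lying over `ρ(D)` meets the kernel in a noetherian piece, which involves only finitely many
relations; the counit carries this information back to `V`.

It remains to pass from finitely generated to arbitrary comodules. For flat `M` the functor `M □_C
-` is left exact, every tensor lives over a finitely generated subcomodule, and an epimorphism
restricts to epimorphisms of finitely generated subobjects (`cotensorSurjective_of_fg`). On the Hom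
side this is Baer's criterion (`ComodLike.injective_of_extends`); for cogenerators, injectivity
extends test morphisms from finitely generated subobjects. The categorical arguments are made once,
for a forgetful functor satisfying `ComodLike`, and used on both sides. -/

set_option linter.unusedSectionVars false

noncomputable section

namespace CoringTheory

/-! ### Kernels, cokernels and short exactness computed on underlying modules -/

section

open Limits

section ConcreteKernels

variable {R : Type u} [Ring R] {𝒴 : Type*} [Category* 𝒴] [Preadditive 𝒴]

/-- The linear map underlying a morphism. -/
abbrev lin (U : 𝒴 ⥤ ModuleCat.{u} R) {X Y : 𝒴} (f : X ⟶ Y) : U.obj X →ₗ[R] U.obj Y :=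
  (U.map f).hom

variable (U : 𝒴 ⥤ ModuleCat.{u} R)

theorem lin_id (X : 𝒴) : lin U (𝟙 X) = LinearMap.id := by simp [lin]

theorem lin_comp {X Y Z : 𝒴} (f : X ⟶ Y) (g : Y ⟶ Z) : lin U (f ≫ g) = lin U g ∘ₗ lin U f := by
  simp [lin]

theorem lin_comp_apply {X Y Z : 𝒴} (f : X ⟶ Y) (g : Y ⟶ Z) (x : U.obj X) :
    lin U (f ≫ g) x = lin U g (lin U f x) := by
  simp [lin]

theorem lin_zero [U.Additive] (X Y : 𝒴) : lin U (0 : X ⟶ Y) = 0 := by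
  simp [lin]

variable {U}

theorem lin_injective [U.Faithful] {X Y : 𝒴} {f g : X ⟶ Y} (h : lin U f = lin U g) : f = g :=
  U.map_injective (ModuleCat.hom_ext h)

/-- The functor `U` to modules creates kernels and cokernels, stated on elements. -/
structure HasConcreteKernels (U : 𝒴 ⥤ ModuleCat.{u} R) : Prop where
  lift : ∀ {X Y Z : 𝒴} (i : Y ⟶ X) (g : Z ⟶ X), Function.Injective (lin U i) →
    LinearMap.range (lin U g) ≤ LinearMap.range (lin U i) → ∃ h : Z ⟶ Y, h ≫ i = g
  desc : ∀ {X Y Z : 𝒴} (p : X ⟶ Y) (g : X ⟶ Z), Function.Surjective (lin U p) →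
    LinearMap.ker (lin U p) ≤ LinearMap.ker (lin U g) → ∃ h : Y ⟶ Z, p ≫ h = g
  exists_kernel : ∀ {X Y : 𝒴} (f : X ⟶ Y), ∃ (K : 𝒴) (i : K ⟶ X),
    Function.Injective (lin U i) ∧ LinearMap.range (lin U i) = LinearMap.ker (lin U f)
  exists_cokernel : ∀ {X Y : 𝒴} (f : X ⟶ Y), ∃ (Q : 𝒴) (p : Y ⟶ Q),
    Function.Surjective (lin U p) ∧ LinearMap.ker (lin U p) = LinearMap.range (lin U f)

theorem mono_of_lin_injective [U.Faithful] {X Y : 𝒴} {f : X ⟶ Y}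
    (hf : Function.Injective (lin U f)) : Mono f where
  right_cancellation g h e := lin_injective (U := U) (LinearMap.ext fun x => hf (by
    rw [← lin_comp_apply, e, lin_comp_apply]))

theorem epi_of_lin_surjective [U.Faithful] {X Y : 𝒴} {f : X ⟶ Y}
    (hf : Function.Surjective (lin U f)) : Epi f where
  left_cancellation g h e := lin_injective (U := U) (LinearMap.ext fun y => by
    obtain ⟨x, rfl⟩ := hf y
    rw [← lin_comp_apply, e, lin_comp_apply])

theorem comp_eq_zero_iff [U.Additive] [U.Faithful] {X Y Z : 𝒴} {f : X ⟶ Y} {g : Y ⟶ Z} :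
    f ≫ g = 0 ↔ LinearMap.range (lin U f) ≤ LinearMap.ker (lin U g) := by
  rw [LinearMap.range_le_ker_iff, ← lin_comp, ← lin_zero U]
  exact ⟨fun h => by rw [h], fun h => lin_injective h⟩

namespace HasConcreteKernels

variable [U.Additive] [U.Faithful] (hU : HasConcreteKernels U)
include hU

/-- A monomorphism annihilates the inclusion of its concrete kernel, so that inclusion is zero and
the linear kernel is trivial. -/
theorem mono_iff {X Y : 𝒴} (f : X ⟶ Y) : Mono f ↔ Function.Injective (lin U f) := by
  refine ⟨fun _ => ?_, mono_of_lin_injective⟩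
  obtain ⟨K, i, -, hi⟩ := hU.exists_kernel f
  have h : i = 0 := by
    rw [← cancel_mono f, zero_comp, comp_eq_zero_iff (U := U), hi]
  rw [h, lin_zero, LinearMap.range_zero] at hi
  exact LinearMap.ker_eq_bot.1 hi.symm

theorem epi_iff {X Y : 𝒴} (f : X ⟶ Y) : Epi f ↔ Function.Surjective (lin U f) := by
  refine ⟨fun _ => ?_, epi_of_lin_surjective⟩
  obtain ⟨Q, p, -, hp⟩ := hU.exists_cokernel f
  have h : p = 0 := by
    rw [← cancel_epi f, comp_zero, comp_eq_zero_iff (U := U), hp]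
  rw [h, lin_zero, LinearMap.ker_zero] at hp
  exact LinearMap.range_eq_top.1 hp.symm

/-- A morphism that is mono and epi is bijective, so the identity of its target lifts through it. -/
theorem balanced : Balanced 𝒴 where
  isIso_of_mono_of_epi {X Y} f _ _ := by
    obtain ⟨h, hh⟩ := hU.lift f (𝟙 Y) ((hU.mono_iff f).1 inferInstance) (by
      rw [LinearMap.range_eq_top.2 ((hU.epi_iff f).1 inferInstance)]; exact le_top)
    exact ⟨h, by rw [← cancel_mono f, Category.assoc, hh, Category.comp_id, Category.id_comp], hh⟩

/-- The kernel of an identity is a zero object; it serves as the homology of a short exact sequence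
in `shortExact_iff`. -/
theorem exists_isZero (X : 𝒴) : ∃ Z : 𝒴, IsZero Z := by
  obtain ⟨K, i, hi, hi'⟩ := hU.exists_kernel (𝟙 X)
  refine ⟨K, (IsZero.iff_id_eq_zero K).2 ?_⟩
  have := mono_of_lin_injective hi
  rw [← cancel_mono i, zero_comp, Category.id_comp]
  refine lin_injective (U := U) ?_
  rw [lin_id, LinearMap.ker_id] at hi'
  rw [lin_zero, LinearMap.range_eq_bot.1 hi']

theorem shortExact_iff (S : ShortComplex 𝒴) :
    S.ShortExact ↔ Function.Injective (lin U S.f) ∧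
      LinearMap.range (lin U S.f) = LinearMap.ker (lin U S.g) ∧
      Function.Surjective (lin U S.g) := by
  constructor
  · intro hS
    have := hU.balanced
    have := hS.mono_f
    have := hS.epi_g
    refine ⟨(hU.mono_iff _).1 inferInstance, le_antisymm (comp_eq_zero_iff.1 S.zero) ?_,
      (hU.epi_iff _).1 inferInstance⟩
    obtain ⟨K, i, -, hi⟩ := hU.exists_kernel S.g
    -- Exactness makes `S.f` a categorical kernel of `S.g`, so the concrete kernel factors through
    -- it.
    have h := hS.exact.lift_f i (comp_eq_zero_iff.2 hi.le)
    rw [← hi, ← h, lin_comp]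
    exact LinearMap.range_comp_le_range _ _
  · rintro ⟨hf, he, hg⟩
    have := mono_of_lin_injective hf
    have := epi_of_lin_surjective hg
    obtain ⟨Z, hZ⟩ := hU.exists_isZero S.X₁
    have hK : Nonempty (IsLimit (KernelFork.ofι S.f S.zero)) := by
      refine ⟨KernelFork.IsLimit.ofι' S.f S.zero fun k hk => ?_⟩
      have h := hU.lift S.f k hf (by rw [he]; exact comp_eq_zero_iff.1 hk)
      exact ⟨h.choose, h.choose_spec⟩
    have hC : Nonempty (IsColimit (CokernelCofork.ofπ S.g S.zero)) := by
      refine ⟨CokernelCofork.IsColimit.ofπ' S.g S.zero fun k hk => ?_⟩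
      have h := hU.desc S.g k hg (by rw [← he]; exact comp_eq_zero_iff.1 hk)
      exact ⟨h.choose, h.choose_spec⟩
    obtain ⟨hK⟩ := hK
    obtain ⟨hC⟩ := hC
    have e₁ : hK.lift (KernelFork.ofι S.f S.zero) = 𝟙 S.X₁ := by
      rw [← cancel_mono S.f]
      exact (Fork.IsLimit.lift_ι hK).trans (Category.id_comp _).symm
    have e₂ : hC.desc (CokernelCofork.ofπ S.g S.zero) = 𝟙 S.X₃ := by
      rw [← cancel_epi S.g]
      exact (Cofork.IsColimit.π_desc hC).trans (Category.comp_id _).symm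
    -- Exactness presupposes homology data. Since `S.f` is a kernel of `S.g` and `S.g` a cokernel of
    -- `S.f`, the maps induced into the kernel and out of the cokernel are the identities `e₁`,
    -- `e₂`, and the homology is the zero object.
    have : S.HasHomology := .mk'
      { left :=
          { K := S.X₁, H := Z, i := S.f, π := 0, wi := S.zero, hi := hK, wπ := comp_zero
            hπ := CokernelCofork.IsColimit.ofπ _ _ (fun _ _ => 0)
              (fun k hk => by
                rw [e₁] at hk
                rw [comp_zero, ← Category.id_comp k]; exact hk.symm)
              (fun _ _ _ _ => hZ.eq_of_src _ _) }
        right :=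
          { Q := S.X₃, H := Z, p := S.g, ι := 0, wp := S.zero, hp := hC, wι := zero_comp
            hι := KernelFork.IsLimit.ofι _ _ (fun _ _ => 0)
              (fun k hk => by
                rw [e₂] at hk
                rw [zero_comp, ← Category.comp_id k]; exact hk.symm)
              (fun _ _ _ _ => hZ.eq_of_tgt _ _) }
        iso := Iso.refl Z
        comm := by simp }
    exact .mk (S.exact_of_f_is_kernel hK)

end HasConcreteKernels

end ConcreteKernels

/-! ### Subobjects as submodules, and the ascending chain condition -/

section Subcomodules

variable {R : Type u} [Ring R] {𝒳 : Type (u + 1)} [Category.{u} 𝒳] [Preadditive 𝒳]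

/-- The submodules of (the module underlying) `X` that come from subobjects. -/
def IsSub (U : 𝒳 ⥤ ModuleCat.{u} R) {X : 𝒳} (S : Submodule R (U.obj X)) : Prop :=
  ∃ (Y : 𝒳) (f : Y ⟶ X), LinearMap.range (lin U f) = S

/-- A category of comodule type over modules: besides kernels and cokernels, subobjects are
closed under sums, and morphisms can be glued along sums. -/
structure ComodLike (U : 𝒳 ⥤ ModuleCat.{u} R) : Prop extends HasConcreteKernels U where
  isSub_sSup : ∀ {X : 𝒳} (s : Set (Submodule R (U.obj X))), (∀ S ∈ s, IsSub U S) →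
    IsSub U (sSup s)
  glue : ∀ {X Z : 𝒳} (s : Set (Submodule R (U.obj X))), sSup s = ⊤ →
    ∀ φ : U.obj X →ₗ[R] U.obj Z,
    (∀ S ∈ s, ∃ (Y : 𝒳) (f : Y ⟶ X) (g : Y ⟶ Z),
      LinearMap.range (lin U f) = S ∧ lin U g = φ ∘ₗ lin U f) → ∃ h : X ⟶ Z, lin U h = φ

variable {U : 𝒳 ⥤ ModuleCat.{u} R}

theorem isSub_range {X Y : 𝒳} (f : Y ⟶ X) : IsSub U (LinearMap.range (lin U f)) := ⟨Y, f, rfl⟩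

theorem IsSub.map {X Y : 𝒳} (f : X ⟶ Y) {S : Submodule R (U.obj X)} (hS : IsSub U S) :
    IsSub U (S.map (lin U f)) := by
  obtain ⟨Z, g, rfl⟩ := hS
  exact ⟨Z, g ≫ f, by rw [lin_comp, LinearMap.range_comp]⟩

/-- The ascending chain condition for the subobjects of `X` contained in `S`. -/
def ChainCondition (U : 𝒳 ⥤ ModuleCat.{u} R) {X : 𝒳} (S : Submodule R (U.obj X)) : Prop :=
  ∀ T : ℕ →o Submodule R (U.obj X), (∀ n, IsSub U (T n)) → (∀ n, T n ≤ S) →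
    ∃ n, ∀ m, n ≤ m → T n = T m

theorem ChainCondition.mono {X : 𝒳} {S T : Submodule R (U.obj X)} (hT : ChainCondition U T)
    (h : S ≤ T) : ChainCondition U S :=
  fun V hV hV' => hT V hV fun n => (hV' n).trans h

/-- Without a maximal member, repeatedly choosing a strictly larger one would give a chain that
never stabilises. -/
theorem ChainCondition.exists_maximal {X : 𝒳} {S : Submodule R (U.obj X)}
    (hS : ChainCondition U S) {s : Set (Submodule R (U.obj X))} (hs : s.Nonempty)
    (hsub : ∀ T ∈ s, IsSub U T) (hle : ∀ T ∈ s, T ≤ S) :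
    ∃ T ∈ s, ∀ T' ∈ s, T ≤ T' → T' = T := by
  by_contra! H
  obtain ⟨T₀, hT₀⟩ := hs
  choose! F hF hF' hF'' using H
  let V : ℕ → s := fun n => Nat.rec ⟨T₀, hT₀⟩ (fun _ T => ⟨F T.1, hF T.1 T.2⟩) n
  have hV : ∀ n, (V (n + 1)).1 = F (V n).1 := fun n => rfl
  obtain ⟨n, hn⟩ := hS ⟨fun n => (V n).1, monotone_nat_of_le_succ fun n => by
    rw [hV]; exact hF' _ (V n).2⟩ (fun n => hsub _ (V n).2) (fun n => hle _ (V n).2)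
  have := hn (n + 1) (Nat.le_succ n)
  exact hF'' _ (V n).2 (this.trans (hV n)).symm

theorem chainCondition_map_of_injective {X Z : 𝒳} (i : Z ⟶ X) (hi : Function.Injective (lin U i))
    (h : ChainCondition U (LinearMap.range (lin U i))) :
    ChainCondition U (⊤ : Submodule R (U.obj Z)) := by
  intro T hT _
  obtain ⟨n, hn⟩ := h ⟨fun n => (T n).map (lin U i), fun a b hab => Submodule.map_mono (T.2 hab)⟩
    (fun n => (hT n).map i) (fun n => LinearMap.map_le_range)
  exact ⟨n, fun m hm => Submodule.map_injective_of_injective hi (hn m hm)⟩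

namespace ComodLike

variable [U.Additive] [U.Faithful] (hU : ComodLike U)
include hU

theorem isSub_bot (X : 𝒳) : IsSub U (⊥ : Submodule R (U.obj X)) := by
  rw [← sSup_empty]; exact hU.isSub_sSup _ (by simp)

theorem isSub_sup {X : 𝒳} {S T : Submodule R (U.obj X)} (hS : IsSub U S) (hT : IsSub U T) :
    IsSub U (S ⊔ T) := by
  rw [← sSup_pair]; exact hU.isSub_sSup _ (by simp [hS, hT])

/-- The preimage of a subobject is the kernel of the composite with the projection to its quotient.
-/
theorem isSub_comap {X Y : 𝒳} (f : X ⟶ Y) {S : Submodule R (U.obj Y)} (hS : IsSub U S) :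
    IsSub U (S.comap (lin U f)) := by
  obtain ⟨Z, g, rfl⟩ := hS
  obtain ⟨Q, p, -, hp⟩ := hU.exists_cokernel g
  obtain ⟨K, i, -, hi⟩ := hU.exists_kernel (f ≫ p)
  exact ⟨K, i, by rw [hi, lin_comp, LinearMap.ker_comp, hp]⟩

/-- The image of a morphism is the kernel of its cokernel. -/
theorem exists_injective {X : 𝒳} {S : Submodule R (U.obj X)} (hS : IsSub U S) :
    ∃ (Y : 𝒳) (i : Y ⟶ X), Function.Injective (lin U i) ∧ LinearMap.range (lin U i) = S := by
  obtain ⟨Z, g, rfl⟩ := hS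
  obtain ⟨Q, p, -, hp⟩ := hU.exists_cokernel g
  obtain ⟨K, i, hi, hi'⟩ := hU.exists_kernel p
  exact ⟨K, i, hi, by rw [hi', hp]⟩

theorem isSub_inf {X : 𝒳} {S T : Submodule R (U.obj X)} (hS : IsSub U S) (hT : IsSub U T) :
    IsSub U (S ⊓ T) := by
  obtain ⟨Z, g, rfl⟩ := hS
  have := (hU.isSub_comap g hT).map g
  rwa [Submodule.map_comap_eq] at this

/-- A chain inside the range is recovered from its preimage by taking images again. -/
theorem chainCondition_range {X Z : 𝒳} (f : Z ⟶ X)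
    (h : ChainCondition U (⊤ : Submodule R (U.obj Z))) :
    ChainCondition U (LinearMap.range (lin U f)) := by
  intro T hT hT'
  obtain ⟨n, hn⟩ := h ⟨fun n => (T n).comap (lin U f), fun a b hab => Submodule.comap_mono (T.2 hab)⟩
    (fun n => hU.isSub_comap f (hT n)) (fun n => le_top)
  refine ⟨n, fun m hm => ?_⟩
  have : ((T n).comap (lin U f)).map (lin U f) = ((T m).comap (lin U f)).map (lin U f) :=
    congrArg (Submodule.map (lin U f)) (hn m hm)
  rwa [Submodule.map_comap_eq, Submodule.map_comap_eq, inf_eq_right.2 (hT' n),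
    inf_eq_right.2 (hT' m)] at this

theorem chainCondition_bot (X : 𝒳) : ChainCondition U (⊥ : Submodule R (U.obj X)) :=
  fun _ _ hT => ⟨0, fun m _ => (le_bot_iff.1 (hT 0)).trans (le_bot_iff.1 (hT m)).symm⟩

/-- A chain is determined by its trace on `S` and its image modulo `S`; the latter is controlled by
`T`. The conclusion is the modular cancellation law for submodules. -/
theorem chainCondition_sup {X : 𝒳} {S T : Submodule R (U.obj X)} (hS' : IsSub U S)
    (hT' : IsSub U T) (hS : ChainCondition U S) (hT : ChainCondition U T) :
    ChainCondition U (S ⊔ T) := by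
  intro V hV hV'
  obtain ⟨n₁, h₁⟩ := hS ⟨fun n => V n ⊓ S, fun a b hab => inf_le_inf_right _ (V.2 hab)⟩
    (fun n => hU.isSub_inf (hV n) hS') (fun n => inf_le_right)
  obtain ⟨n₂, h₂⟩ := hT ⟨fun n => (V n ⊔ S) ⊓ T,
      fun a b hab => inf_le_inf_right _ (sup_le_sup_right (V.2 hab) _)⟩
    (fun n => hU.isSub_inf (hU.isSub_sup (hV n) hS') hT') (fun n => inf_le_right)
  -- By modularity `V n ⊔ S`, which lies between `S` and `S ⊔ T`, is recovered from its intersection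
  -- with `T`.
  have key : ∀ n, V n ⊔ S = S ⊔ (V n ⊔ S) ⊓ T := fun n => by
    rw [inf_comm, ← sup_inf_assoc_of_le T (le_sup_right : S ≤ V n ⊔ S), eq_comm, inf_eq_right]
    exact sup_le (hV' n) le_sup_left
  refine ⟨max n₁ n₂, fun m hm => ?_⟩
  have e₁ : V (max n₁ n₂) ⊓ S = V m ⊓ S :=
    (h₁ _ (le_max_left _ _)).symm.trans (h₁ _ ((le_max_left _ _).trans hm))
  have e₂ : (V (max n₁ n₂) ⊔ S) ⊓ T = (V m ⊔ S) ⊓ T :=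
    (h₂ _ (le_max_right _ _)).symm.trans (h₂ _ ((le_max_right _ _).trans hm))
  refine eq_of_le_of_inf_le_of_sup_le (z := S) (V.2 hm) e₁.ge ?_
  rw [key m, ← e₂, ← key]

/-- Together with `exists_subobject` this translates categorical finiteness conditions into
conditions on `IsSub` submodules. -/
theorem subobject_le_iff {X : 𝒳} (P Q : Subobject X) : P ≤ Q ↔
    LinearMap.range (lin U P.arrow) ≤ LinearMap.range (lin U Q.arrow) := by
  constructor
  · intro h
    rw [← Subobject.ofLE_arrow h, lin_comp]
    exact LinearMap.range_comp_le_range _ _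
  · intro h
    obtain ⟨f, hf⟩ := hU.lift Q.arrow P.arrow ((hU.mono_iff _).1 inferInstance) h
    exact Subobject.le_of_comm f hf

theorem exists_subobject {X : 𝒳} {S : Submodule R (U.obj X)} (hS : IsSub U S) :
    ∃ P : Subobject X, LinearMap.range (lin U P.arrow) = S := by
  obtain ⟨Y, i, hi, rfl⟩ := hU.exists_injective hS
  have := mono_of_lin_injective hi
  refine ⟨Subobject.mk i, le_antisymm ?_ ?_⟩
  · have h := congrArg (lin U) (Subobject.underlyingIso_hom_comp_eq_mk i)
    rw [lin_comp] at h
    rw [← h]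
    exact LinearMap.range_comp_le_range _ _
  · have h := congrArg (lin U) (Subobject.underlyingIso_arrow i)
    rw [lin_comp] at h
    rw [← h]
    exact LinearMap.range_comp_le_range _ _

end ComodLike

end Subcomodules

end

/-! ### Noetherian subobjects in a locally noetherian category -/

section

section Noetherian

variable {R : Type u} [Ring R] {𝒳 : Type (u + 1)} [Category.{u} 𝒳] [Preadditive 𝒳]
  {U : 𝒳 ⥤ ModuleCat.{u} R} [U.Additive] [U.Faithful]

namespace ComodLike

variable (hU : ComodLike U)
include hU

/-- A maximal member of a directed family is its greatest member, hence its supremum. -/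
theorem finitelyGenerated_of_chainCondition {X : 𝒳}
    (h : ChainCondition U (⊤ : Submodule R (U.obj X))) : finitelyGenerated 𝒳 X := by
  intro s hs hdir hlub
  obtain ⟨_, ⟨P, hP, rfl⟩, hmax⟩ := h.exists_maximal
    (s := (fun P : Subobject X => LinearMap.range (lin U P.arrow)) '' s) (hs.image _)
    (by rintro _ ⟨P, -, rfl⟩; exact isSub_range _) (fun _ _ => le_top)
  have : P = ⊤ := by
    refine top_le_iff.1 (hlub.2 fun Q hQ => ?_)
    obtain ⟨P', hP', hPP', hQP'⟩ := hdir P hP Q hQ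
    refine hQP'.trans ?_
    rw [hU.subobject_le_iff]
    exact (hmax _ ⟨P', hP', rfl⟩ ((hU.subobject_le_iff _ _).1 hPP')).le
  exact this ▸ hP

theorem top_mem_of_finitelyGenerated {X : 𝒳} (hX : finitelyGenerated 𝒳 X)
    {s : Set (Submodule R (U.obj X))} (hsub : ∀ S ∈ s, IsSub U S) (hs : s.Nonempty)
    (hdir : DirectedOn (· ≤ ·) s) (hsup : sSup s = ⊤) : ⊤ ∈ s := by
  have htop : LinearMap.range (lin U (⊤ : Subobject X).arrow) = ⊤ :=
    LinearMap.range_eq_top.2 ((hU.epi_iff _).1 inferInstance)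
  have := hX {P | LinearMap.range (lin U P.arrow) ∈ s} (by
      obtain ⟨S, hS⟩ := hs
      obtain ⟨P, rfl⟩ := hU.exists_subobject (hsub S hS)
      exact ⟨P, hS⟩) (by
      intro P hP Q hQ
      obtain ⟨S, hS, h₁, h₂⟩ := hdir _ hP _ hQ
      obtain ⟨V, rfl⟩ := hU.exists_subobject (hsub S hS)
      exact ⟨V, hS, (hU.subobject_le_iff _ _).2 h₁, (hU.subobject_le_iff _ _).2 h₂⟩)
    ⟨fun _ _ => le_top, fun Q hQ => by
      rw [hU.subobject_le_iff, htop, ← hsup]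
      refine sSup_le fun S hS => ?_
      obtain ⟨V, rfl⟩ := hU.exists_subobject (hsub S hS)
      exact (hU.subobject_le_iff _ _).1 (hQ hS)⟩
  rwa [Set.mem_ofPred_eq, htop] at this

theorem chainCondition_of_isNoetherianObject {X : 𝒳} (hX : IsNoetherianObject X) :
    ChainCondition U (⊤ : Submodule R (U.obj X)) := by
  intro T hT _
  choose P hP using fun n => hU.exists_subobject (hT n)
  obtain ⟨n, hn⟩ := (isNoetherianObject_iff_monotone_chain_condition X).1 hX
    ⟨P, fun a b hab => (hU.subobject_le_iff _ _).2 (by rw [hP, hP]; exact T.2 hab)⟩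
  refine ⟨n, fun m hm => ?_⟩
  rw [← hP, ← hP]
  exact congrArg (fun Q : Subobject X => LinearMap.range (lin U Q.arrow)) (hn m hm)

/-- The noetherian subobjects of `X`. -/
def _root_.CoringTheory.noetherianSubs (U : 𝒳 ⥤ ModuleCat.{u} R) (X : 𝒳) :
    Set (Submodule R (U.obj X)) :=
  {S | IsSub U S ∧ ChainCondition U S}

theorem noetherianSubs_nonempty (X : 𝒳) : (noetherianSubs U X).Nonempty :=
  ⟨⊥, hU.isSub_bot X, hU.chainCondition_bot X⟩

theorem noetherianSubs_sup {X : 𝒳} {S T : Submodule R (U.obj X)} (hS : S ∈ noetherianSubs U X)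
    (hT : T ∈ noetherianSubs U X) : S ⊔ T ∈ noetherianSubs U X :=
  ⟨hU.isSub_sup hS.1 hT.1, hU.chainCondition_sup hS.1 hT.1 hS.2 hT.2⟩

theorem noetherianSubs_directed (X : 𝒳) : DirectedOn (· ≤ ·) (noetherianSubs U X) :=
  fun S hS T hT => ⟨S ⊔ T, hU.noetherianSubs_sup hS hT, le_sup_left, le_sup_right⟩

variable (hN : IsLocallyNoetherian 𝒳)
include hN

/-- The image of a noetherian generator is noetherian, so every morphism from a generator dies in
the quotient by the sum of all noetherian subobjects. As generators separate morphisms, the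
projection to this quotient is zero. -/
theorem sSup_noetherianSubs (X : 𝒳) : sSup (noetherianSubs U X) = ⊤ := by
  obtain ⟨ι, G, hG, hsep⟩ := hN
  obtain ⟨Y, f, hf⟩ := hU.isSub_sSup (noetherianSubs U X) fun S hS => hS.1
  obtain ⟨Q, p, -, hp⟩ := hU.exists_cokernel f
  have h0 : p = 0 := by
    refine hsep _ _ fun _ hi h => ?_
    obtain ⟨i⟩ := hi
    rw [Limits.comp_zero, comp_eq_zero_iff (U := U), hp, hf]
    exact le_sSup ⟨isSub_range h,
      hU.chainCondition_range h (hU.chainCondition_of_isNoetherianObject (hG i))⟩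
  rw [← hf, ← hp, h0, lin_zero, LinearMap.ker_zero]

/-- Every object is the directed union of its noetherian subobjects, and a finitely generated one
equals a member of this family. -/
theorem finitelyGenerated_iff (X : 𝒳) :
    finitelyGenerated 𝒳 X ↔ ChainCondition U (⊤ : Submodule R (U.obj X)) :=
  ⟨fun h => (hU.top_mem_of_finitelyGenerated h (fun _ hS => hS.1) (hU.noetherianSubs_nonempty X)
    (hU.noetherianSubs_directed X) (hU.sSup_noetherianSubs hN X)).2,
    hU.finitelyGenerated_of_chainCondition⟩

theorem finitelyGenerated_of_injective {X Y : 𝒳} (i : X ⟶ Y) (hi : Function.Injective (lin U i))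
    (hY : finitelyGenerated 𝒳 Y) : finitelyGenerated 𝒳 X := by
  rw [hU.finitelyGenerated_iff hN] at hY ⊢
  exact chainCondition_map_of_injective i hi (hY.mono le_top)

theorem finitelyGenerated_of_surjective {X Y : 𝒳} (p : X ⟶ Y)
    (hp : Function.Surjective (lin U p)) (hX : finitelyGenerated 𝒳 X) :
    finitelyGenerated 𝒳 Y := by
  rw [hU.finitelyGenerated_iff hN] at hX ⊢
  rw [← LinearMap.range_eq_top.2 hp]
  exact hU.chainCondition_range p hX

theorem exists_mem_noetherianSubs {X : 𝒳} (x : U.obj X) : ∃ S ∈ noetherianSubs U X, x ∈ S := by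
  rw [← Submodule.mem_sSup_of_directed (hU.noetherianSubs_nonempty X)
    (hU.noetherianSubs_directed X), hU.sSup_noetherianSubs hN]
  trivial

/-- A noetherian subobject of `Y` in the image of `f : X ⟶ Y` is the image of a noetherian
subobject of `X`. -/
theorem exists_map_eq {X Y : 𝒳} (f : X ⟶ Y) {T : Submodule R (U.obj Y)}
    (hT : T ∈ noetherianSubs U Y) (hle : T ≤ LinearMap.range (lin U f)) :
    ∃ S ∈ noetherianSubs U X, S.map (lin U f) = T := by
  let s := (Submodule.map (lin U f)) ''
    {S | S ∈ noetherianSubs U X ∧ S ≤ T.comap (lin U f)}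
  obtain ⟨_, ⟨S, ⟨hS, hST⟩, rfl⟩, hmax⟩ := hT.2.exists_maximal (s := s)
    ⟨_, ⊥, ⟨⟨hU.isSub_bot X, hU.chainCondition_bot X⟩, bot_le⟩, rfl⟩
    (by rintro _ ⟨S, hS, rfl⟩; exact hS.1.1.map f)
    (by rintro _ ⟨S, hS, rfl⟩; exact Submodule.map_le_iff_le_comap.2 hS.2)
  refine ⟨S, hS, le_antisymm (Submodule.map_le_iff_le_comap.2 hST) fun y hy => ?_⟩
  obtain ⟨x, rfl⟩ := hle hy
  obtain ⟨V, hV, hx⟩ := hU.exists_mem_noetherianSubs hN x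
  -- Adjoining to `S` this noetherian piece, which contains `x`, does not change the image, since
  -- the image of `S` is maximal; so `y` is already attained.
  have hV' : V ⊓ T.comap (lin U f) ∈ noetherianSubs U X :=
    ⟨hU.isSub_inf hV.1 (hU.isSub_comap f hT.1), hV.2.mono inf_le_left⟩
  rw [← hmax _ ⟨_, ⟨hU.noetherianSubs_sup hS hV', sup_le hST inf_le_right⟩, rfl⟩
    (Submodule.map_mono le_sup_left)]
  exact Submodule.mem_map_of_mem (Submodule.mem_sup_right ⟨hx, hy⟩)

-- Noetherian subobjects are compact with respect to directed unions: choose `S` with `T ⊓ S`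
-- maximal; any element of `T` lies in a member above `S`, whose trace on `T` is no larger.
omit hN in
theorem exists_le_of_le_sSup {X : 𝒳} {T : Submodule R (U.obj X)} (hT : T ∈ noetherianSubs U X)
    {s : Set (Submodule R (U.obj X))} (hs : s.Nonempty) (hdir : DirectedOn (· ≤ ·) s)
    (hsub : ∀ S ∈ s, IsSub U S) (hle : T ≤ sSup s) : ∃ S ∈ s, T ≤ S := by
  obtain ⟨_, ⟨S, hS, rfl⟩, hmax⟩ := hT.2.exists_maximal (s := (fun S => T ⊓ S) '' s)
    (hs.image _) (by rintro _ ⟨S, hS, rfl⟩; exact hU.isSub_inf hT.1 (hsub S hS))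
    (by rintro _ ⟨S, hS, rfl⟩; exact inf_le_left)
  refine ⟨S, hS, fun x hx => ?_⟩
  obtain ⟨V, hV, hxV⟩ := (Submodule.mem_sSup_of_directed hs hdir).1 (hle hx)
  obtain ⟨W, hW, hSW, hVW⟩ := hdir S hS V hV
  have : x ∈ T ⊓ W := ⟨hx, hVW hxV⟩
  exact ((hmax _ ⟨W, hW, rfl⟩ (inf_le_inf_left _ hSW)).le this).2

theorem exists_finitelyGenerated_of_mem {X : 𝒳} {S : Submodule R (U.obj X)}
    (hS : S ∈ noetherianSubs U X) : ∃ (Y : 𝒳) (i : Y ⟶ X), finitelyGenerated 𝒳 Y ∧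
      Function.Injective (lin U i) ∧ LinearMap.range (lin U i) = S := by
  obtain ⟨Y, i, hi, rfl⟩ := hU.exists_injective hS.1
  exact ⟨Y, i, (hU.finitelyGenerated_iff hN Y).2 (chainCondition_map_of_injective i hi hS.2),
    hi, rfl⟩

/-! ### Baer's criterion -/

omit hU hN in
/-- The partial linear map defined by a morphism on a subobject. -/
noncomputable def _root_.CoringTheory.partialHom {X Y Z : 𝒳} (i : Y ⟶ X)
    (hi : Function.Injective (lin U i)) (g : Y ⟶ Z) : U.obj X →ₗ.[R] U.obj Z :=
  ⟨LinearMap.range (lin U i), lin U g ∘ₗ (LinearEquiv.ofInjective (lin U i) hi).symm.toLinearMap⟩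

omit hU hN in
theorem _root_.CoringTheory.partialHom_apply {X Y Z : 𝒳} (i : Y ⟶ X)
    (hi : Function.Injective (lin U i)) (g : Y ⟶ Z) (y : U.obj Y)
    (h : lin U i y ∈ (partialHom i hi g).domain) :
    partialHom i hi g ⟨lin U i y, h⟩ = lin U g y := by
  have : (LinearEquiv.ofInjective (lin U i) hi).symm ⟨lin U i y, h⟩ = y := by
    rw [LinearEquiv.symm_apply_eq]; rfl
  exact congrArg (lin U g) this

omit hU hN in
/-- A partial linear map is a partial morphism if it is given by a morphism on a subobject. -/
def _root_.CoringTheory.IsPartialHom (U : 𝒳 ⥤ ModuleCat.{u} R) {X Z : 𝒳}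
    (φ : U.obj X →ₗ.[R] U.obj Z) : Prop :=
  ∃ (Y : 𝒳) (i : Y ⟶ X) (hi : Function.Injective (lin U i)) (g : Y ⟶ Z), φ = partialHom i hi g

-- Used both for the upper bound of a chain in Zorn's lemma and for joining two compatible partial
-- morphisms.
omit hN in
theorem isPartialHom_of_le {X Z : 𝒳} (φ : U.obj X →ₗ.[R] U.obj Z)
    (c : Set (U.obj X →ₗ.[R] U.obj Z)) (hc : ∀ ψ ∈ c, IsPartialHom U ψ) (hle : ∀ ψ ∈ c, ψ ≤ φ)
    (hdom : φ.domain = sSup (LinearPMap.domain '' c)) : IsPartialHom U φ := by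
  obtain ⟨Y, i, hi, hY⟩ := hU.exists_injective (hU.isSub_sSup (LinearPMap.domain '' c) (by
    rintro _ ⟨ψ, hψ, rfl⟩
    obtain ⟨W, j, hj, g, rfl⟩ := hc ψ hψ
    exact isSub_range j))
  rw [← hdom] at hY
  have hmem : ∀ y, lin U i y ∈ φ.domain := fun y => hY ▸ LinearMap.mem_range_self _ y
  -- The domains in `c` pull back along `i` to subobjects covering `Y`. On each of them `φ` is a
  -- morphism, so these morphisms glue.
  obtain ⟨g, hg⟩ := hU.glue (X := Y) (Z := Z)
    ((Submodule.comap (lin U i)) '' (LinearPMap.domain '' c)) (by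
      apply Submodule.map_injective_of_injective hi
      rw [sSup_image, Submodule.map_iSup, Submodule.map_top, hY, hdom, sSup_eq_iSup]
      refine iSup_congr fun S => ?_
      rw [Submodule.map_iSup]
      refine iSup_congr fun hS => ?_
      rw [Submodule.map_comap_eq, inf_eq_right, hY, hdom]
      exact le_sSup hS)
    (φ.toFun ∘ₗ LinearMap.codRestrict φ.domain (lin U i) hmem) (by
      rintro _ ⟨_, ⟨ψ, hψ, rfl⟩, rfl⟩
      have hψφ := hle ψ hψ
      obtain ⟨W, j, hj, g, rfl⟩ := hc ψ hψ
      obtain ⟨h, hh⟩ := hU.lift i j hi (by rw [hY]; exact hψφ.1)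
      have hh' : ∀ w, lin U i (lin U h w) = lin U j w := fun w => by rw [← lin_comp_apply, hh]
      refine ⟨W, h, g, ?_, ?_⟩
      · ext y
        constructor
        · rintro ⟨w, rfl⟩
          exact ⟨w, (hh' w).symm⟩
        · rintro ⟨w, hw⟩
          exact ⟨w, hi ((hh' w).trans hw)⟩
      · ext w
        have := hψφ.2 (x := ⟨lin U j w, ⟨w, rfl⟩⟩) (y := ⟨lin U i (lin U h w), hmem _⟩) (hh' w).symm
        exact (partialHom_apply j hj g w _).symm.trans this)
  refine ⟨Y, i, hi, g, LinearPMap.ext hY.symm fun x hx hx' => ?_⟩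
  obtain ⟨y, rfl⟩ := hx'
  exact (LinearMap.congr_fun hg y).symm.trans (partialHom_apply i hi g y _).symm

/-- Baer's criterion: in a locally noetherian category it suffices to extend morphisms along
monomorphisms of finitely generated objects. -/
theorem injective_of_extends (M : 𝒳)
    (hM : ∀ {X Y : 𝒳} (_ : finitelyGenerated 𝒳 X) (_ : finitelyGenerated 𝒳 Y) (i : X ⟶ Y)
      (_ : Function.Injective (lin U i)) (g : X ⟶ M), ∃ h : Y ⟶ M, i ≫ h = g) :
    Injective M where
  factors {X Z} g m hm := by
    have hm' := (hU.mono_iff m).1 hm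
    -- Take a maximal partial morphism extending `g`, regarded as defined on the image of `m`.
    obtain ⟨φ, hle, ⟨hφ, hφmax⟩⟩ := zorn_le_nonempty₀ {φ : U.obj Z →ₗ.[R] U.obj M | IsPartialHom U φ}
      (fun c hc hchain φ₀ hφ₀ => ⟨LinearPMap.sSup c hchain.directedOn,
        hU.isPartialHom_of_le _ c hc (fun ψ hψ => LinearPMap.le_sSup _ hψ)
          (LinearPMap.domain_sSup _),
        fun ψ hψ => LinearPMap.le_sSup _ hψ⟩)
      (partialHom m hm' g) ⟨X, m, hm', g, rfl⟩
    obtain ⟨Y, i, hi, f, rfl⟩ := hφ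
    have htop : LinearMap.range (lin U i) = ⊤ := by
      refine top_le_iff.1 fun z _ => ?_
      obtain ⟨F, hF, hzF⟩ := hU.exists_mem_noetherianSubs hN z
      obtain ⟨E, iE, hE, hiE, hrE⟩ := hU.exists_finitelyGenerated_of_mem hN hF
      -- `W` is the intersection of the maximal domain with a finitely generated `E` containing `z`.
      -- It is finitely generated as a subobject of `E`, so the restriction of `f` to `W` extends to
      -- `E`. The extension agrees with `f` on the overlap, and joining the two contradicts
      -- maximality unless `z` was in the domain.
      obtain ⟨W, iW, hiW, hrW⟩ := hU.exists_injective (hU.isSub_inf (isSub_range i) (isSub_range iE))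
      obtain ⟨a, ha⟩ := hU.lift iE iW hiE (hrW.le.trans inf_le_right)
      obtain ⟨b, hb⟩ := hU.lift i iW hi (hrW.le.trans inf_le_left)
      have ha' : ∀ w, lin U iE (lin U a w) = lin U iW w := fun w => by rw [← lin_comp_apply, ha]
      have hb' : ∀ w, lin U i (lin U b w) = lin U iW w := fun w => by rw [← lin_comp_apply, hb]
      have hai : Function.Injective (lin U a) := fun w w' h => hiW (by rw [← ha', h, ha'])
      obtain ⟨e, he⟩ := hM (hU.finitelyGenerated_of_injective hN a hai hE) hE a hai (b ≫ f)
      have hcompat : ∀ (x : (partialHom i hi f).domain) (y : (partialHom iE hiE e).domain),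
          (x : U.obj Z) = y → partialHom i hi f x = partialHom iE hiE e y := by
        rintro ⟨_, x, rfl⟩ ⟨_, y, rfl⟩ (hxy : lin U i x = lin U iE y)
        have hx : lin U i x ∈ LinearMap.range (lin U iW) := by
          rw [hrW]; exact ⟨⟨x, rfl⟩, ⟨y, hxy.symm⟩⟩
        obtain ⟨w, hw⟩ := hx
        have hxw : x = lin U b w := hi (by rw [hb', hw])
        have hyw : y = lin U a w := hiE (by rw [ha', hw, hxy])
        refine (partialHom_apply i hi f x _).trans (Eq.trans ?_ (partialHom_apply iE hiE e y _).symm)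
        rw [hxw, hyw, ← lin_comp_apply, ← lin_comp_apply, he]
      have hle₁ := LinearPMap.left_le_sup _ _ hcompat
      have hle₂ := LinearPMap.right_le_sup _ _ hcompat
      have := hφmax (hU.isPartialHom_of_le (LinearPMap.sup _ _ hcompat)
        {partialHom i hi f, partialHom iE hiE e}
        (by rintro _ (rfl | rfl); exacts [⟨_, _, _, _, rfl⟩, ⟨_, _, _, _, rfl⟩])
        (by rintro _ (rfl | rfl); exacts [hle₁, hle₂])
        (by rw [Set.image_pair, sSup_pair]; rfl)) hle₁
      exact (hle₂.trans this).1 (show z ∈ LinearMap.range (lin U iE) from hrE ▸ hzF)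
    obtain ⟨h, hh⟩ := hU.lift i (𝟙 Z) hi (htop ▸ le_top)
    refine ⟨h ≫ f, lin_injective (U := U) (LinearMap.ext fun x => ?_)⟩
    have e₁ : lin U m x = lin U i (lin U h (lin U m x)) := by
      rw [← lin_comp_apply, hh, lin_id]; rfl
    have := hle.2 (x := ⟨lin U m x, ⟨x, rfl⟩⟩) (y := ⟨lin U i (lin U h (lin U m x)), ⟨_, rfl⟩⟩) e₁
    rw [lin_comp_apply, lin_comp_apply]
    exact (partialHom_apply i hi f _ _).symm.trans (this.symm.trans (partialHom_apply m hm' g x _))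

end ComodLike

end Noetherian

end

/-! ### Tensor products over a noncommutative ring: exactness and detection of zero -/

section

namespace BTensor

variable {k A : Type u} [CommRing k] [Ring A] [Algebra k A]
variable {M : Type u} [AddCommGroup M] [Module k M] [Module Aᵐᵒᵖ M] [IsScalarTower k Aᵐᵒᵖ M]
variable {M' : Type u} [AddCommGroup M'] [Module k M'] [Module Aᵐᵒᵖ M'] [IsScalarTower k Aᵐᵒᵖ M']
variable {M'' : Type u} [AddCommGroup M''] [Module k M''] [Module Aᵐᵒᵖ M'']
  [IsScalarTower k Aᵐᵒᵖ M'']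
variable {N : Type u} [AddCommGroup N] [Module k N] [Module A N] [IsScalarTower k A N]
variable {N' : Type u} [AddCommGroup N'] [Module k N'] [Module A N'] [IsScalarTower k A N']
variable {N'' : Type u} [AddCommGroup N''] [Module k N''] [Module A N''] [IsScalarTower k A N'']
variable {C : Type u} [AddCommGroup C] [Module k C] [Module A C] [Module Aᵐᵒᵖ C]
  [SMulCommClass A Aᵐᵒᵖ C] [IsScalarTower k A C] [IsScalarTower k Aᵐᵒᵖ C]

/-! ### Right exactness and flatness -/

theorem map_surjective {f : M →ₗ[Aᵐᵒᵖ] M'} {g : N →ₗ[A] N'} (hf : Function.Surjective f)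
    (hg : Function.Surjective g) : Function.Surjective (map k f g) := by
  intro x
  induction x using induction_on with
  | zero => exact ⟨0, map_zero _⟩
  | tmul m n =>
    obtain ⟨m, rfl⟩ := hf m
    obtain ⟨n, rfl⟩ := hg n
    exact ⟨tmul k A m n, rfl⟩
  | add x y hx hy =>
    obtain ⟨x, rfl⟩ := hx
    obtain ⟨y, rfl⟩ := hy
    exact ⟨x + y, map_add _ _ _⟩

/-- A set-theoretic section of `f` becomes additive and balanced modulo the image `I` of `M ⊗ g`. It
thus yields a map from `M ⊗ N''` to the cokernel whose composite with `M ⊗ f` is the projection. -/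
theorem exact_map_right (M : Type u) [AddCommGroup M] [Module k M] [Module Aᵐᵒᵖ M]
    [IsScalarTower k Aᵐᵒᵖ M] {g : N →ₗ[A] N'} {f : N' →ₗ[A] N''} (hf : Function.Surjective f)
    (hfg : LinearMap.ker f ≤ LinearMap.range g) {x : BTensor k A M N'}
    (hx : map k (LinearMap.id : M →ₗ[Aᵐᵒᵖ] M) f x = 0) :
    ∃ y, map k (LinearMap.id : M →ₗ[Aᵐᵒᵖ] M) g y = x := by
  let I := LinearMap.range (map k (LinearMap.id : M →ₗ[Aᵐᵒᵖ] M) g)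
  have hI : ∀ (m : M) (n n' : N'), f n = f n' →
      I.mkQ (tmul k A m n) = I.mkQ (tmul k A m n') := by
    intro m n n' h
    obtain ⟨z, hz⟩ := hfg (show n - n' ∈ LinearMap.ker f by rw [LinearMap.mem_ker, map_sub, h, sub_self])
    rw [← sub_eq_zero, ← map_sub, ← map_sub, Submodule.mkQ_apply, Submodule.Quotient.mk_eq_zero]
    exact ⟨tmul k A m z, by rw [map_tmul, hz]; rfl⟩
  let σ : N'' → N' := Function.surjInv hf
  have hσ : ∀ q, f (σ q) = q := Function.surjInv_eq hf
  let s : BTensor k A M N'' →ₗ[k] (BTensor k A M N' ⧸ I) :=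
    lift (LinearMap.mk₂ k (fun m q => I.mkQ (tmul k A m (σ q)))
      (fun m m' q => by rw [add_tmul, map_add])
      (fun r m q => by rw [base_smul_tmul, map_smul])
      (fun m q q' => by
        rw [← map_add, ← tmul_add]
        exact hI _ _ _ (by rw [hσ, map_add, hσ, hσ]))
      (fun r m q => by
        rw [← map_smul, ← tmul_base_smul]
        exact hI _ _ _ (by rw [hσ, LinearMap.map_smul_of_tower, hσ])))
      (fun m a q => by
        simp only [LinearMap.mk₂_apply]
        rw [op_smul_tmul]
        exact hI _ _ _ (by rw [hσ, map_smul, hσ]))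
  have hs : s ∘ₗ map k LinearMap.id f = I.mkQ := hom_ext fun m n => by
    change I.mkQ (tmul k A m (σ (f n))) = _
    exact hI _ _ _ (hσ _)
  have := LinearMap.congr_fun hs x
  rw [LinearMap.comp_apply, hx, map_zero, eq_comm, Submodule.mkQ_apply,
    Submodule.Quotient.mk_eq_zero] at this
  exact this

theorem exact_map_left (N : Type u) [AddCommGroup N] [Module k N] [Module A N]
    [IsScalarTower k A N] {g : M →ₗ[Aᵐᵒᵖ] M'} {f : M' →ₗ[Aᵐᵒᵖ] M''}
    (hf : Function.Surjective f) (hfg : LinearMap.ker f ≤ LinearMap.range g)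
    {x : BTensor k A M' N} (hx : map k f (LinearMap.id : N →ₗ[A] N) x = 0) :
    ∃ y, map k g (LinearMap.id : N →ₗ[A] N) y = x := by
  let I := LinearMap.range (map k g (LinearMap.id : N →ₗ[A] N))
  have hI : ∀ (m m' : M') (n : N), f m = f m' →
      I.mkQ (tmul k A m n) = I.mkQ (tmul k A m' n) := by
    intro m m' n h
    obtain ⟨z, hz⟩ := hfg (show m - m' ∈ LinearMap.ker f by rw [LinearMap.mem_ker, map_sub, h, sub_self])
    rw [← sub_eq_zero, ← map_sub, ← LinearMap.sub_apply, ← map_sub, Submodule.mkQ_apply,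
      Submodule.Quotient.mk_eq_zero]
    exact ⟨tmul k A z n, by rw [map_tmul, hz]; rfl⟩
  let σ : M'' → M' := Function.surjInv hf
  have hσ : ∀ q, f (σ q) = q := Function.surjInv_eq hf
  let s : BTensor k A M'' N →ₗ[k] (BTensor k A M' N ⧸ I) :=
    lift (LinearMap.mk₂ k (fun q n => I.mkQ (tmul k A (σ q) n))
      (fun q q' n => by
        rw [← map_add, ← add_tmul]
        exact hI _ _ _ (by rw [hσ, map_add, hσ, hσ]))
      (fun r q n => by
        rw [← map_smul, ← base_smul_tmul]
        exact hI _ _ _ (by rw [hσ, LinearMap.map_smul_of_tower, hσ]))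
      (fun q n n' => by rw [tmul_add, map_add])
      (fun r q n => by rw [tmul_base_smul, map_smul]))
      (fun q a n => by
        simp only [LinearMap.mk₂_apply]
        rw [← op_smul_tmul]
        exact hI _ _ _ (by rw [hσ, map_smul, hσ]))
  have hs : s ∘ₗ map k f LinearMap.id = I.mkQ := hom_ext fun m n => by
    change I.mkQ (tmul k A (σ (f m)) n) = _
    exact hI _ _ _ (hσ _)
  have := LinearMap.congr_fun hs x
  rw [LinearMap.comp_apply, hx, map_zero, eq_comm, Submodule.mkQ_apply,
    Submodule.Quotient.mk_eq_zero] at this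
  exact this

/-- Factor `f` through its range: flatness removes the inclusion of the range, and right exactness
handles the surjective part. -/
theorem _root_.CoringTheory.RightFlat.exists_of_map_eq_zero (hM : RightFlat k A M)
    (f : N →ₗ[A] N') {x : BTensor k A M N}
    (hx : map k (LinearMap.id : M →ₗ[Aᵐᵒᵖ] M) f x = 0) :
    ∃ y, map k (LinearMap.id : M →ₗ[Aᵐᵒᵖ] M) (LinearMap.ker f).subtype y = x := by
  refine exact_map_right M (f := f.rangeRestrict) f.surjective_rangeRestrict
    (by rw [LinearMap.ker_rangeRestrict, Submodule.range_subtype]) ?_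
  refine hM _ _ _ (LinearMap.range f).injective_subtype ?_
  rw [map_map, map_zero]
  exact hx

theorem _root_.CoringTheory.LeftFlat.exists_of_map_eq_zero (hN : LeftFlat k A N)
    (f : M →ₗ[Aᵐᵒᵖ] M') {x : BTensor k A M N}
    (hx : map k f (LinearMap.id : N →ₗ[A] N) x = 0) :
    ∃ y, map k (LinearMap.ker f).subtype (LinearMap.id : N →ₗ[A] N) y = x := by
  refine exact_map_left N (f := f.rangeRestrict) f.surjective_rangeRestrict
    (by rw [LinearMap.ker_rangeRestrict, Submodule.range_subtype]) ?_
  refine hN _ _ _ (LinearMap.range f).injective_subtype ?_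
  rw [map_map, map_zero]
  exact hx

/-! ### Module structures on maps -/

variable (k) in
/-- The map `f ⊗_A C` as a right linear map. -/
def mapRight (f : M →ₗ[Aᵐᵒᵖ] M') : BTensor k A M C →ₗ[Aᵐᵒᵖ] BTensor k A M' C where
  toFun := map k f LinearMap.id
  map_add' := map_add _
  map_smul' a x := by
    induction x using induction_on with
    | zero => simp
    | tmul m n => simp
    | add x y hx hy => simp only [smul_add, map_add, hx, hy]

variable (k) in
/-- The map `C ⊗_A g` as a left linear map. -/
def mapLeft (g : N →ₗ[A] N') : BTensor k A C N →ₗ[A] BTensor k A C N' where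
  toFun := map k LinearMap.id g
  map_add' := map_add _
  map_smul' a x := by
    induction x using induction_on with
    | zero => simp
    | tmul m n => simp
    | add x y hx hy => simp only [smul_add, map_add, hx, hy]

theorem contractRight_smul (g : N →ₗ[A] A) (a : A) (x : BTensor k A C N) :
    contractRight g (a • x) = a • contractRight g x := by
  induction x using induction_on with
  | zero => simp
  | tmul m n => exact (smul_comm _ _ _).symm
  | add x y hx hy => simp only [smul_add, map_add, hx, hy]

variable (k) in
/-- The right linear map `n ↦ m ⊗ n` for a bimodule. -/
def tmulRight (m : M) : C →ₗ[Aᵐᵒᵖ] BTensor k A M C where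
  toFun := tmul k A m
  map_add' := tmul_add m
  map_smul' _ _ := rfl

variable (k) in
/-- The contraction with a bimodule form `g : C → A` as a right linear map. -/
def contractRightHom (g : C →ₗ[A] A)
    (hg : ∀ (a : Aᵐᵒᵖ) (c : C), g (a • c) = a • g c) : BTensor k A M C →ₗ[Aᵐᵒᵖ] M where
  toFun := contractRight g
  map_add' := map_add _
  map_smul' a x := by
    induction x using induction_on with
    | zero => simp
    | tmul m n =>
      simp only [op_smul_tmul', contractRight_tmul, hg, RingHom.id_apply, smul_smul]
      rfl
    | add x y hx hy => simp only [smul_add, map_add, hx, hy]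

/-! ### Naturality -/

theorem contractRight_map (f : M →ₗ[Aᵐᵒᵖ] M') (h : N →ₗ[A] N') (g : N' →ₗ[A] A)
    (x : BTensor k A M N) : contractRight g (map k f h x) = f (contractRight (g ∘ₗ h) x) := by
  induction x using induction_on with
  | zero => simp
  | tmul m n => simp
  | add x y hx hy => simp only [map_add, hx, hy]

theorem contractLeft_map (f : M →ₗ[Aᵐᵒᵖ] M') (h : N →ₗ[A] N') (g : M' →ₗ[Aᵐᵒᵖ] A)
    (x : BTensor k A M N) : contractLeft g (map k f h x) = h (contractLeft (g ∘ₗ f) x) := by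
  induction x using induction_on with
  | zero => simp
  | tmul m n => simp
  | add x y hx hy => simp only [map_add, hx, hy]

theorem assoc_map_left (f : M →ₗ[Aᵐᵒᵖ] M') (x : BTensor k A (BTensor k A M C) N) :
    assoc (map k (mapRight k f) LinearMap.id x) = map k f LinearMap.id (assoc x) := by
  induction x using induction_on with
  | zero => simp
  | tmul m n =>
    induction m using induction_on with
    | zero => simp
    | tmul m c => rfl
    | add x y hx hy => simp only [add_tmul, map_add, hx, hy]
  | add x y hx hy => simp only [map_add, hx, hy]

theorem assoc_map_right (g : N →ₗ[A] N') (x : BTensor k A (BTensor k A M C) N) :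
    assoc (map k LinearMap.id g x) = map k LinearMap.id (mapLeft k g) (assoc x) := by
  induction x using induction_on with
  | zero => simp
  | tmul m n =>
    induction m using induction_on with
    | zero => simp
    | tmul m c => rfl
    | add x y hx hy => simp only [add_tmul, map_add, hx, hy]
  | add x y hx hy => simp only [map_add, hx, hy]

/-- The inverse of `assoc`. -/
def assocInv : BTensor k A M (BTensor k A C N) →ₗ[k] BTensor k A (BTensor k A M C) N :=
  lift (LinearMap.mk₂ k (fun m y => map k (tmulRight k m) LinearMap.id y)
    (fun m m' y => by
      rw [← LinearMap.add_apply, ← map_add_left]; congr 2; ext c; exact add_tmul m m' c)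
    (fun r m y => by
      rw [← LinearMap.smul_apply, ← map_smul_left]; congr 2)
    (fun m y y' => map_add _ _ _)
    (fun r m y => map_smul _ _ _))
    (fun m a y => by
      simp only [LinearMap.mk₂_apply]
      induction y using induction_on with
      | zero => simp
      | tmul c n => exact congrArg (fun z => tmul k A z n) (op_smul_tmul k A m a c)
      | add x y hx hy => simp only [smul_add, map_add, hx, hy])

theorem assocInv_assoc (x : BTensor k A (BTensor k A M C) N) : assocInv (assoc x) = x := by
  induction x using induction_on with
  | zero => simp
  | tmul m n =>
    induction m using induction_on with
    | zero => simp
    | tmul m c => rfl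
    | add x y hx hy => simp only [add_tmul, map_add, hx, hy]
  | add x y hx hy => simp only [map_add, hx, hy]

theorem assoc_assocInv (x : BTensor k A M (BTensor k A C N)) : assoc (assocInv x) = x := by
  induction x using induction_on with
  | zero => simp
  | tmul m y =>
    induction y using induction_on with
    | zero => simp
    | tmul c n => rfl
    | add x y hx hy => simp only [map_add, hx, hy]
  | add x y hx hy => simp only [map_add, hx, hy]

theorem assoc_injective : Function.Injective
    (assoc : BTensor k A (BTensor k A M C) N →ₗ[k] BTensor k A M (BTensor k A C N)) :=
  Function.LeftInverse.injective assocInv_assoc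

/-! ### Vanishing of tensors -/

theorem contractRight_id_injective :
    Function.Injective (contractRight (LinearMap.id : A →ₗ[A] A) : BTensor k A M A →ₗ[k] M) := by
  have h : (mk k A M A).flip 1 ∘ₗ contractRight LinearMap.id = LinearMap.id :=
    hom_ext fun m a => by
      change tmul k A (op a • m) (1 : A) = tmul k A m a
      rw [op_smul_tmul, smul_eq_mul, mul_one]
  exact Function.LeftInverse.injective (g := (mk k A M A).flip 1) (LinearMap.congr_fun h)

/-- A tensor over a finite power is the sum of its components, each reinserted in its place. -/
theorem eq_zero_of_map_proj_eq_zero {n : ℕ} {z : BTensor k A M (Fin n → N)}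
    (hz : ∀ i, map k (LinearMap.id : M →ₗ[Aᵐᵒᵖ] M)
      (LinearMap.proj i : (Fin n → N) →ₗ[A] N) z = 0) : z = 0 := by
  have h : z = ∑ i, map k (LinearMap.id : M →ₗ[Aᵐᵒᵖ] M) (LinearMap.single A (fun _ => N) i)
      (map k LinearMap.id (LinearMap.proj i : (Fin n → N) →ₗ[A] N) z) := by
    clear hz
    induction z using induction_on with
    | zero => simp
    | tmul m v =>
      simp only [map_tmul, LinearMap.id_apply, LinearMap.coe_single, LinearMap.proj_apply]
      rw [← map_sum, Finset.univ_sum_single]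
    | add x y hx hy =>
      simp only [map_add, Finset.sum_add_distrib]
      rw [← hx, ← hy]
  rw [h]
  simp [hz]

/-- Finitely many jointly injective linear forms on `N` detect vanishing in `M ⊗_A N`, for flat
`M`. -/
theorem eq_zero_of_contractRight_eq_zero (hM : RightFlat k A M) {n : ℕ}
    (φ : Fin n → N →ₗ[A] A) (hφ : Function.Injective (LinearMap.pi φ)) {x : BTensor k A M N}
    (hx : ∀ i, contractRight (φ i) x = 0) : x = 0 := by
  -- Flatness embeds `M ⊗ N` in `M ⊗ A^n`, whose components, read in `M`, are the contractions by
  -- the forms `φ i`.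
  refine hM _ _ (LinearMap.pi φ) hφ ?_
  rw [map_zero]
  refine eq_zero_of_map_proj_eq_zero fun i => ?_
  refine contractRight_id_injective ?_
  rw [map_map, contractRight_map, map_zero]
  exact hx i

/-- For flat right modules `M` and `C`, the forms on `N` detect vanishing in `M ⊗_A C ⊗_A N`. -/
theorem eq_zero_of_map_contractRight_eq_zero (hM : RightFlat k A M) (hC : RightFlat k A C) {n : ℕ}
    (φ : Fin n → N →ₗ[A] A) (hφ : Function.Injective (LinearMap.pi φ))
    (ψ : Fin n → BTensor k A C N →ₗ[A] C) (hψ : ∀ i x, ψ i x = contractRight (φ i) x)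
    {x : BTensor k A M (BTensor k A C N)}
    (hx : ∀ i, map k (LinearMap.id : M →ₗ[Aᵐᵒᵖ] M) (ψ i) x = 0) : x = 0 := by
  -- Flatness of `C` makes the maps `ψ i` jointly injective on `C ⊗ N`; flatness of `M` preserves
  -- this embedding into `C^n`.
  refine hM _ _ (LinearMap.pi ψ) ?_ ?_
  · refine (injective_iff_map_eq_zero _).2 fun y hy => ?_
    exact eq_zero_of_contractRight_eq_zero hC φ hφ fun i => (hψ i y).symm.trans (congrFun hy i)
  · rw [map_zero]
    refine eq_zero_of_map_proj_eq_zero fun i => ?_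
    rw [map_map]
    exact hx i

end BTensor

end

/-! ### Right comodules: subcomodules, quotients and gluing -/

section

open BTensor

variable {k A C : Type u} [CommRing k] [Ring A] [Algebra k A] [AddCommGroup C] [Module k C]
    [Module A C] [Module Aᵐᵒᵖ C] [SMulCommClass A Aᵐᵒᵖ C] [IsScalarTower k A C]
    [IsScalarTower k Aᵐᵒᵖ C] [Coring k A C]

namespace RightComod

theorem coact_linearMap {X Y : RightComod k A C} (f : X ⟶ Y) (x : X.carrier) :
    Y.coact (linearMap f x) = BTensor.map k (linearMap f) LinearMap.id (X.coact x) :=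
  (f.2 x).symm

section Sub

variable (hC : LeftFlat k A C) (X : RightComod k A C) (S : Submodule Aᵐᵒᵖ X.carrier)
  (hS : ∀ x ∈ S, X.coact x ∈ LinearMap.range (mapRight (C := C) k S.subtype))

/-- The coaction on a subcomodule. -/
def subCoact : S →ₗ[Aᵐᵒᵖ] BTensor k A S C :=
  (LinearEquiv.ofInjective (mapRight (C := C) k S.subtype)
    (hC _ _ S.subtype S.injective_subtype)).symm.toLinearMap ∘ₗ
    LinearMap.codRestrict _ (X.coact ∘ₗ S.subtype) (fun x => hS x x.2)

theorem map_subCoact (x : S) :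
    BTensor.map k S.subtype (LinearMap.id : C →ₗ[A] C) (subCoact hC X S hS x) = X.coact x :=
  congrArg Subtype.val ((LinearEquiv.ofInjective (mapRight (C := C) k S.subtype)
    (hC _ _ S.subtype S.injective_subtype)).apply_symm_apply
      (LinearMap.codRestrict _ (X.coact ∘ₗ S.subtype) (fun x => hS x x.2) x))

theorem mapRight_subCoact :
    mapRight (C := C) k S.subtype ∘ₗ subCoact hC X S hS = X.coact ∘ₗ S.subtype :=
  LinearMap.ext fun x => map_subCoact hC X S hS x

/-- A subcomodule as a comodule. -/
def sub : RightComod k A C where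
  carrier := S
  coact := subCoact hC X S hS
  coassoc x := by
    -- Coassociativity is tested in `X ⊗ C ⊗ C`. Reassociating places the inclusion of `S` in the
    -- left factor, where flatness of `C` as a left module applies twice.
    rw [← assoc_assocInv (BTensor.map k LinearMap.id _ (subCoact hC X S hS x))]
    congr 1
    apply hC _ _ (mapRight (C := C) k S.subtype) (hC _ _ S.subtype S.injective_subtype)
    apply assoc_injective
    rw [map_map, mapRight_subCoact, assoc_map_left, assoc_assocInv, map_map]
    have h₁ := X.coassoc x
    rw [← map_subCoact hC X S hS x, map_map, map_map] at h₁
    exact h₁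
  counit x := by
    apply S.injective_subtype
    have h₁ := X.counit x
    rw [← map_subCoact hC X S hS x, contractRight_map] at h₁
    exact h₁

/-- The inclusion of a subcomodule. -/
def subι : sub hC X S hS ⟶ X := ⟨S.subtype, map_subCoact hC X S hS⟩

end Sub

section Quotient

variable (X : RightComod k A C) (S : Submodule Aᵐᵒᵖ X.carrier)
  (hS : ∀ x ∈ S, X.coact x ∈ LinearMap.range (mapRight (C := C) k S.subtype))

/-- The coaction on a quotient comodule. -/
def quotCoact : (X.carrier ⧸ S) →ₗ[Aᵐᵒᵖ] BTensor k A (X.carrier ⧸ S) C :=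
  S.liftQ (mapRight (C := C) k S.mkQ ∘ₗ X.coact) fun x hx => by
    obtain ⟨y, hy⟩ := hS x hx
    have h : S.mkQ ∘ₗ S.subtype = 0 := by ext; simp
    rw [LinearMap.mem_ker, LinearMap.comp_apply, ← hy]
    refine (map_map S.subtype S.mkQ (LinearMap.id : C →ₗ[A] C) LinearMap.id y).trans ?_
    rw [h, map_zero_left]
    rfl

theorem quotCoact_mk (x : X.carrier) : quotCoact X S hS (S.mkQ x) =
    BTensor.map k S.mkQ (LinearMap.id : C →ₗ[A] C) (X.coact x) := rfl

/-- The quotient by a subcomodule. -/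
def quot : RightComod k A C where
  carrier := X.carrier ⧸ S
  coact := quotCoact X S hS
  coassoc x := by
    obtain ⟨x, rfl⟩ := S.mkQ_surjective x
    have h : quotCoact X S hS ∘ₗ S.mkQ = mapRight (C := C) k S.mkQ ∘ₗ X.coact := rfl
    rw [quotCoact_mk, map_map, map_map, h]
    have h₁ := congrArg (BTensor.map k S.mkQ LinearMap.id) (X.coassoc x)
    rw [← assoc_map_left, map_map, map_map] at h₁
    exact h₁
  counit x := by
    obtain ⟨x, rfl⟩ := S.mkQ_surjective x
    rw [quotCoact_mk, contractRight_map]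
    exact congrArg S.mkQ (X.counit x)

/-- The projection to a quotient comodule. -/
def quotπ : X ⟶ quot X S hS := ⟨S.mkQ, fun _ => rfl⟩

end Quotient

theorem coact_mem_range_of_range_le {X Y : RightComod k A C} (f : Y ⟶ X)
    {S : Submodule Aᵐᵒᵖ X.carrier} (h : LinearMap.range (linearMap f) ≤ S) (y : Y.carrier) :
    X.coact (linearMap f y) ∈ LinearMap.range (mapRight (C := C) k S.subtype) := by
  rw [coact_linearMap]
  refine ⟨BTensor.map k (LinearMap.codRestrict S (linearMap f) fun y => h ⟨y, rfl⟩)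
    LinearMap.id (Y.coact y), ?_⟩
  exact map_map _ _ _ _ _

/-- `f ⊗ C` kills the coaction of an element of the kernel, and by flatness the kernel of `f ⊗ C`
comes from `ker f ⊗ C`. -/
theorem coact_mem_range_ker (hC : LeftFlat k A C) {X Y : RightComod k A C} (f : X ⟶ Y)
    (x : X.carrier) (hx : x ∈ LinearMap.ker (linearMap f)) :
    X.coact x ∈ LinearMap.range (mapRight (C := C) k (LinearMap.ker (linearMap f)).subtype) := by
  refine hC.exists_of_map_eq_zero (linearMap f) ?_
  rw [← coact_linearMap, hx, map_zero]

theorem coact_mem_range_sSup {X : RightComod k A C} (s : Set (Submodule Aᵐᵒᵖ X.carrier))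
    (hs : ∀ S ∈ s, ∃ (Y : RightComod k A C) (f : Y ⟶ X), LinearMap.range (linearMap f) = S)
    (x : X.carrier) (hx : x ∈ sSup s) :
    X.coact x ∈ LinearMap.range (mapRight (C := C) k (sSup s).subtype) := by
  have h : sSup s ≤ (LinearMap.range (mapRight (C := C) k (sSup s).subtype)).comap X.coact := by
    refine sSup_le fun S hS => ?_
    obtain ⟨Y, f, hf⟩ := hs S hS
    intro x hx
    obtain ⟨y, rfl⟩ := hf.ge hx
    exact coact_mem_range_of_range_le f (hf.le.trans (le_sSup hS)) y
  exact h hx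

/-- The linear lift is automatically colinear because `i ⊗ C` is injective. -/
theorem exists_lift (hC : LeftFlat k A C) {X Y Z : RightComod k A C} (i : Y ⟶ X) (g : Z ⟶ X)
    (hi : Function.Injective (linearMap i))
    (hle : LinearMap.range (linearMap g) ≤ LinearMap.range (linearMap i)) :
    ∃ h : Z ⟶ Y, h ≫ i = g := by
  let e := LinearEquiv.ofInjective (linearMap i) hi
  let φ : Z.carrier →ₗ[Aᵐᵒᵖ] Y.carrier := e.symm.toLinearMap ∘ₗ
    LinearMap.codRestrict (LinearMap.range (linearMap i)) (linearMap g) fun z => hle ⟨z, rfl⟩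
  have hφ : linearMap i ∘ₗ φ = linearMap g := LinearMap.ext fun z =>
    congrArg Subtype.val (e.apply_symm_apply
      (LinearMap.codRestrict (LinearMap.range (linearMap i)) (linearMap g)
        (fun z => hle ⟨z, rfl⟩) z))
  refine ⟨⟨φ, fun z => ?_⟩, Subtype.ext hφ⟩
  apply hC _ _ (linearMap i) hi
  rw [map_map, hφ, ← coact_linearMap]
  exact (coact_linearMap g z).symm.trans
    (congrArg X.coact (LinearMap.congr_fun hφ z).symm)

theorem exists_desc {X Y Z : RightComod k A C} (p : X ⟶ Y) (g : X ⟶ Z)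
    (hp : Function.Surjective (linearMap p))
    (hle : LinearMap.ker (linearMap p) ≤ LinearMap.ker (linearMap g)) :
    ∃ h : Y ⟶ Z, p ≫ h = g := by
  let φ : Y.carrier →ₗ[Aᵐᵒᵖ] Z.carrier :=
    (LinearMap.ker (linearMap p)).liftQ (linearMap g) hle ∘ₗ
      (LinearMap.quotKerEquivOfSurjective (linearMap p) hp).symm.toLinearMap
  have hφ : φ ∘ₗ linearMap p = linearMap g := LinearMap.ext fun x => by
    have : (LinearMap.quotKerEquivOfSurjective (linearMap p) hp).symm (linearMap p x) =
        (LinearMap.ker (linearMap p)).mkQ x := by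
      rw [LinearEquiv.symm_apply_eq]; rfl
    exact congrArg ((LinearMap.ker (linearMap p)).liftQ (linearMap g) hle) this
  refine ⟨⟨φ, fun y => ?_⟩, Subtype.ext hφ⟩
  obtain ⟨x, rfl⟩ := hp y
  rw [coact_linearMap, map_map, hφ]
  exact (coact_linearMap g x).symm.trans
    (congrArg Z.coact (LinearMap.congr_fun hφ x).symm)

/-- The elements at which a linear map respects the coactions form a submodule, so colinearity can
be checked on a generating family of subcomodules. -/
theorem exists_glue {X Z : RightComod k A C} (s : Set (Submodule Aᵐᵒᵖ X.carrier))
    (hs : sSup s = ⊤) (φ : X.carrier →ₗ[Aᵐᵒᵖ] Z.carrier)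
    (H : ∀ S ∈ s, ∃ (Y : RightComod k A C) (f : Y ⟶ X) (g : Y ⟶ Z),
      LinearMap.range (linearMap f) = S ∧ linearMap g = φ ∘ₗ linearMap f) :
    ∃ h : X ⟶ Z, linearMap h = φ := by
  have : sSup s ≤ LinearMap.eqLocus (mapRight (C := C) k φ ∘ₗ X.coact) (Z.coact ∘ₗ φ) := by
    refine sSup_le fun S hS => ?_
    obtain ⟨Y, f, g, rfl, hg⟩ := H S hS
    rintro _ ⟨y, rfl⟩
    have e₁ := coact_linearMap f y
    have e₂ := coact_linearMap g y
    rw [hg] at e₂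
    refine Eq.trans ?_ e₂.symm
    change BTensor.map k φ LinearMap.id (X.coact (linearMap f y)) = _
    rw [e₁, map_map]
    rfl
  rw [hs] at this
  exact ⟨⟨φ, fun x => this (Submodule.mem_top (x := x))⟩, rfl⟩

variable (k A C) in
/-- The forgetful functor to right modules. -/
def forget : RightComod k A C ⥤ ModuleCat.{u} Aᵐᵒᵖ where
  obj X := ModuleCat.of _ X.carrier
  map f := ModuleCat.ofHom (linearMap f)

instance : (forget k A C).Additive where

instance : (forget k A C).Faithful where
  map_injective h := Subtype.ext (congrArg ModuleCat.Hom.hom h)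

/-- Flatness makes `S ⊗ C → X ⊗ C` injective, so a submodule whose coaction lands in the image of `S
⊗ C` is a comodule; kernels and sums of images are of this kind. Quotients need no flatness. -/
theorem comodLike (hC : LeftFlat k A C) : ComodLike (forget k A C) where
  lift i g hi hle := exists_lift hC i g hi hle
  desc p g hp hle := exists_desc p g hp hle
  exists_kernel f := ⟨_, subι hC _ _ (coact_mem_range_ker hC f),
    Subtype.val_injective, Submodule.range_subtype _⟩
  exists_cokernel {X Y} f := ⟨_, quotπ Y (LinearMap.range (linearMap f)) (by
      rintro _ ⟨x, rfl⟩
      exact coact_mem_range_of_range_le f le_rfl x),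
    Submodule.mkQ_surjective _, Submodule.ker_mkQ _⟩
  isSub_sSup s hs := ⟨_, subι hC _ _ (coact_mem_range_sSup s hs), Submodule.range_subtype _⟩
  glue s hs φ H := exists_glue s hs φ H

end RightComod

end

/-! ### Left comodules: the mirror image, with flatness of `C` as a right module -/

section

open BTensor

variable {k A C : Type u} [CommRing k] [Ring A] [Algebra k A] [AddCommGroup C] [Module k C]
    [Module A C] [Module Aᵐᵒᵖ C] [SMulCommClass A Aᵐᵒᵖ C] [IsScalarTower k A C]
    [IsScalarTower k Aᵐᵒᵖ C] [Coring k A C]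

namespace LeftComod

theorem coact_linearMap {X Y : LeftComod k A C} (f : X ⟶ Y) (x : X.carrier) :
    Y.coact (linearMap f x) = BTensor.map k LinearMap.id (linearMap f) (X.coact x) :=
  (f.2 x).symm

section Sub

variable (hC : RightFlat k A C) (X : LeftComod k A C) (S : Submodule A X.carrier)
  (hS : ∀ x ∈ S, X.coact x ∈ LinearMap.range (mapLeft (C := C) k S.subtype))

/-- The coaction on a subcomodule. -/
def subCoact : S →ₗ[A] BTensor k A C S :=
  (LinearEquiv.ofInjective (mapLeft (C := C) k S.subtype)
    (hC _ _ S.subtype S.injective_subtype)).symm.toLinearMap ∘ₗ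
    LinearMap.codRestrict _ (X.coact ∘ₗ S.subtype) (fun x => hS x x.2)

theorem map_subCoact (x : S) :
    BTensor.map k (LinearMap.id : C →ₗ[Aᵐᵒᵖ] C) S.subtype (subCoact hC X S hS x) = X.coact x :=
  congrArg Subtype.val ((LinearEquiv.ofInjective (mapLeft (C := C) k S.subtype)
    (hC _ _ S.subtype S.injective_subtype)).apply_symm_apply
      (LinearMap.codRestrict _ (X.coact ∘ₗ S.subtype) (fun x => hS x x.2) x))

theorem mapLeft_subCoact :
    mapLeft (C := C) k S.subtype ∘ₗ subCoact hC X S hS = X.coact ∘ₗ S.subtype :=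
  LinearMap.ext fun x => map_subCoact hC X S hS x

/-- A subcomodule as a comodule. -/
def sub : LeftComod k A C where
  carrier := S
  coact := subCoact hC X S hS
  coassoc x := by
    apply hC _ _ (mapLeft (C := C) k S.subtype) (hC _ _ S.subtype S.injective_subtype)
    rw [map_map, mapLeft_subCoact, ← assoc_map_right, map_map]
    have h₁ := X.coassoc x
    rw [← map_subCoact hC X S hS x, map_map, map_map] at h₁
    exact h₁
  counit x := by
    apply S.injective_subtype
    have h₁ := X.counit x
    rw [← map_subCoact hC X S hS x, contractLeft_map] at h₁
    exact h₁

/-- The inclusion of a subcomodule. -/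
def subι : sub hC X S hS ⟶ X := ⟨S.subtype, map_subCoact hC X S hS⟩

end Sub

section Quotient

variable (X : LeftComod k A C) (S : Submodule A X.carrier)
  (hS : ∀ x ∈ S, X.coact x ∈ LinearMap.range (mapLeft (C := C) k S.subtype))

/-- The coaction on a quotient comodule. -/
def quotCoact : (X.carrier ⧸ S) →ₗ[A] BTensor k A C (X.carrier ⧸ S) :=
  S.liftQ (mapLeft (C := C) k S.mkQ ∘ₗ X.coact) fun x hx => by
    obtain ⟨y, hy⟩ := hS x hx
    have h : S.mkQ ∘ₗ S.subtype = 0 := by ext; simp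
    rw [LinearMap.mem_ker, LinearMap.comp_apply, ← hy]
    refine (map_map (LinearMap.id : C →ₗ[Aᵐᵒᵖ] C) LinearMap.id S.subtype S.mkQ y).trans ?_
    rw [h, map_zero_right]
    rfl

theorem quotCoact_mk (x : X.carrier) : quotCoact X S hS (S.mkQ x) =
    BTensor.map k (LinearMap.id : C →ₗ[Aᵐᵒᵖ] C) S.mkQ (X.coact x) := rfl

/-- The quotient by a subcomodule. -/
def quot : LeftComod k A C where
  carrier := X.carrier ⧸ S
  coact := quotCoact X S hS
  coassoc x := by
    obtain ⟨x, rfl⟩ := S.mkQ_surjective x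
    have h : quotCoact X S hS ∘ₗ S.mkQ = mapLeft (C := C) k S.mkQ ∘ₗ X.coact := rfl
    rw [quotCoact_mk, map_map, map_map, h]
    have h₁ := congrArg (BTensor.map k LinearMap.id (mapLeft (C := C) k S.mkQ)) (X.coassoc x)
    rw [← assoc_map_right, map_map, map_map] at h₁
    exact h₁
  counit x := by
    obtain ⟨x, rfl⟩ := S.mkQ_surjective x
    rw [quotCoact_mk, contractLeft_map]
    exact congrArg S.mkQ (X.counit x)

/-- The projection to a quotient comodule. -/
def quotπ : X ⟶ quot X S hS := ⟨S.mkQ, fun _ => rfl⟩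

end Quotient

theorem coact_mem_range_of_range_le {X Y : LeftComod k A C} (f : Y ⟶ X)
    {S : Submodule A X.carrier} (h : LinearMap.range (linearMap f) ≤ S) (y : Y.carrier) :
    X.coact (linearMap f y) ∈ LinearMap.range (mapLeft (C := C) k S.subtype) := by
  rw [coact_linearMap]
  refine ⟨BTensor.map k LinearMap.id (LinearMap.codRestrict S (linearMap f) fun y => h ⟨y, rfl⟩)
    (Y.coact y), ?_⟩
  exact map_map _ _ _ _ _

theorem coact_mem_range_ker (hC : RightFlat k A C) {X Y : LeftComod k A C} (f : X ⟶ Y)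
    (x : X.carrier) (hx : x ∈ LinearMap.ker (linearMap f)) :
    X.coact x ∈ LinearMap.range (mapLeft (C := C) k (LinearMap.ker (linearMap f)).subtype) := by
  refine hC.exists_of_map_eq_zero (linearMap f) ?_
  rw [← coact_linearMap, hx, map_zero]

theorem coact_mem_range_sSup {X : LeftComod k A C} (s : Set (Submodule A X.carrier))
    (hs : ∀ S ∈ s, ∃ (Y : LeftComod k A C) (f : Y ⟶ X), LinearMap.range (linearMap f) = S)
    (x : X.carrier) (hx : x ∈ sSup s) :
    X.coact x ∈ LinearMap.range (mapLeft (C := C) k (sSup s).subtype) := by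
  have h : sSup s ≤ (LinearMap.range (mapLeft (C := C) k (sSup s).subtype)).comap X.coact := by
    refine sSup_le fun S hS => ?_
    obtain ⟨Y, f, hf⟩ := hs S hS
    intro x hx
    obtain ⟨y, rfl⟩ := hf.ge hx
    exact coact_mem_range_of_range_le f (hf.le.trans (le_sSup hS)) y
  exact h hx

theorem exists_lift (hC : RightFlat k A C) {X Y Z : LeftComod k A C} (i : Y ⟶ X) (g : Z ⟶ X)
    (hi : Function.Injective (linearMap i))
    (hle : LinearMap.range (linearMap g) ≤ LinearMap.range (linearMap i)) :
    ∃ h : Z ⟶ Y, h ≫ i = g := by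
  let e := LinearEquiv.ofInjective (linearMap i) hi
  let φ : Z.carrier →ₗ[A] Y.carrier := e.symm.toLinearMap ∘ₗ
    LinearMap.codRestrict (LinearMap.range (linearMap i)) (linearMap g) fun z => hle ⟨z, rfl⟩
  have hφ : linearMap i ∘ₗ φ = linearMap g := LinearMap.ext fun z =>
    congrArg Subtype.val (e.apply_symm_apply
      (LinearMap.codRestrict (LinearMap.range (linearMap i)) (linearMap g)
        (fun z => hle ⟨z, rfl⟩) z))
  refine ⟨⟨φ, fun z => ?_⟩, Subtype.ext hφ⟩
  apply hC _ _ (linearMap i) hi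
  rw [map_map, hφ, ← coact_linearMap]
  exact (coact_linearMap g z).symm.trans
    (congrArg X.coact (LinearMap.congr_fun hφ z).symm)

theorem exists_desc {X Y Z : LeftComod k A C} (p : X ⟶ Y) (g : X ⟶ Z)
    (hp : Function.Surjective (linearMap p))
    (hle : LinearMap.ker (linearMap p) ≤ LinearMap.ker (linearMap g)) :
    ∃ h : Y ⟶ Z, p ≫ h = g := by
  let φ : Y.carrier →ₗ[A] Z.carrier :=
    (LinearMap.ker (linearMap p)).liftQ (linearMap g) hle ∘ₗ
      (LinearMap.quotKerEquivOfSurjective (linearMap p) hp).symm.toLinearMap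
  have hφ : φ ∘ₗ linearMap p = linearMap g := LinearMap.ext fun x => by
    have : (LinearMap.quotKerEquivOfSurjective (linearMap p) hp).symm (linearMap p x) =
        (LinearMap.ker (linearMap p)).mkQ x := by
      rw [LinearEquiv.symm_apply_eq]; rfl
    exact congrArg ((LinearMap.ker (linearMap p)).liftQ (linearMap g) hle) this
  refine ⟨⟨φ, fun y => ?_⟩, Subtype.ext hφ⟩
  obtain ⟨x, rfl⟩ := hp y
  rw [coact_linearMap, map_map, hφ]
  exact (coact_linearMap g x).symm.trans
    (congrArg Z.coact (LinearMap.congr_fun hφ x).symm)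

theorem exists_glue {X Z : LeftComod k A C} (s : Set (Submodule A X.carrier))
    (hs : sSup s = ⊤) (φ : X.carrier →ₗ[A] Z.carrier)
    (H : ∀ S ∈ s, ∃ (Y : LeftComod k A C) (f : Y ⟶ X) (g : Y ⟶ Z),
      LinearMap.range (linearMap f) = S ∧ linearMap g = φ ∘ₗ linearMap f) :
    ∃ h : X ⟶ Z, linearMap h = φ := by
  have : sSup s ≤ LinearMap.eqLocus (mapLeft (C := C) k φ ∘ₗ X.coact) (Z.coact ∘ₗ φ) := by
    refine sSup_le fun S hS => ?_
    obtain ⟨Y, f, g, rfl, hg⟩ := H S hS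
    rintro _ ⟨y, rfl⟩
    have e₁ := coact_linearMap f y
    have e₂ := coact_linearMap g y
    rw [hg] at e₂
    refine Eq.trans ?_ e₂.symm
    change BTensor.map k LinearMap.id φ (X.coact (linearMap f y)) = _
    rw [e₁, map_map]
    rfl
  rw [hs] at this
  exact ⟨⟨φ, fun x => this (Submodule.mem_top (x := x))⟩, rfl⟩

variable (k A C) in
/-- The forgetful functor to left modules. -/
def forget : LeftComod k A C ⥤ ModuleCat.{u} A where
  obj X := ModuleCat.of _ X.carrier
  map f := ModuleCat.ofHom (linearMap f)

instance : (forget k A C).Additive where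

instance : (forget k A C).Faithful where
  map_injective h := Subtype.ext (congrArg ModuleCat.Hom.hom h)

theorem comodLike (hC : RightFlat k A C) : ComodLike (forget k A C) where
  lift i g hi hle := exists_lift hC i g hi hle
  desc p g hp hle := exists_desc p g hp hle
  exists_kernel f := ⟨_, subι hC _ _ (coact_mem_range_ker hC f),
    Subtype.val_injective, Submodule.range_subtype _⟩
  exists_cokernel {X Y} f := ⟨_, quotπ Y (LinearMap.range (linearMap f)) (by
      rintro _ ⟨x, rfl⟩
      exact coact_mem_range_of_range_le f le_rfl x),
    Submodule.mkQ_surjective _, Submodule.ker_mkQ _⟩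
  isSub_sSup s hs := ⟨_, subι hC _ _ (coact_mem_range_sSup s hs), Submodule.range_subtype _⟩
  glue s hs φ H := exists_glue s hs φ H

end LeftComod

end

/-! ### Cofree comodules and finite presentation of finitely generated comodules -/

section

open BTensor

variable {k A C : Type u} [CommRing k] [Ring A] [Algebra k A] [AddCommGroup C] [Module k C]
    [Module A C] [Module Aᵐᵒᵖ C] [SMulCommClass A Aᵐᵒᵖ C] [IsScalarTower k A C]
    [IsScalarTower k Aᵐᵒᵖ C] [Coring k A C]

namespace RightComod

section Cofree

variable (V : Type u) [AddCommGroup V] [Module k V] [Module Aᵐᵒᵖ V] [IsScalarTower k Aᵐᵒᵖ V]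
variable {W : Type u} [AddCommGroup W] [Module k W] [Module Aᵐᵒᵖ W] [IsScalarTower k Aᵐᵒᵖ W]

/-- The coaction `V ⊗ Δ` of the cofree comodule. -/
def cofreeCoact : BTensor k A V C →ₗ[Aᵐᵒᵖ] BTensor k A (BTensor k A V C) C where
  toFun x := assocInv (BTensor.map k LinearMap.id (Coring.comul (k := k) (A := A) (C := C)).left x)
  map_add' x y := by rw [map_add, map_add]
  map_smul' a x := by
    induction x using induction_on with
    | zero => simp
    | tmul v c =>
      exact (congrArg (mapRight (C := C) k (tmulRight (C := C) k v))
        ((Coring.comul (k := k) (A := A) (C := C)).map_op_smul a c)).trans (map_smul _ _ _)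
    | add x y hx hy => simp only [smul_add, map_add, hx, hy]

/-- The cofree right comodule `V ⊗_A C`. -/
def cofree : RightComod k A C where
  carrier := BTensor k A V C
  coact := cofreeCoact V
  coassoc x := by
    induction x using induction_on with
    | zero => simp
    | tmul v c =>
      have h₀ : (cofreeCoact (C := C) V : BTensor k A V C →ₗ[Aᵐᵒᵖ] _) ∘ₗ tmulRight (C := C) k v =
          mapRight (C := C) k (tmulRight (C := C) k v) ∘ₗ
            (Coring.comul (k := k) (A := A) (C := C)).right := rfl
      have h₁ : cofreeCoact (C := C) V (BTensor.tmul k A v c) =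
        BTensor.map k (tmulRight (C := C) k v) LinearMap.id
          ((Coring.comul (k := k) (A := A) (C := C)).left c) := rfl
      have h₂ := congrArg (BTensor.map k (tmulRight (C := C) k v) LinearMap.id)
        (Coring.coassoc (k := k) (A := A) c)
      rw [← assoc_map_left, map_map, map_map] at h₂
      rw [h₁, map_map, map_map, h₀]
      exact h₂
    | add x y hx hy => simp only [map_add, hx, hy]
  counit x := by
    induction x using induction_on with
    | zero => simp
    | tmul v c =>
      refine (contractRight_map (tmulRight (C := C) k v) LinearMap.id _ _).trans ?_
      exact congrArg (BTensor.tmul k A v) (Coring.counit_right (k := k) (A := A) c)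
    | add x y hx hy => simp only [map_add, hx, hy]

variable {V}

/-- The comodule morphism `f ⊗_A C`. -/
def cofreeMap (f : V →ₗ[Aᵐᵒᵖ] W) : (cofree V : RightComod k A C) ⟶ cofree W :=
  ⟨mapRight (C := C) k f, fun x => by
    change BTensor.map k (mapRight (C := C) k f) LinearMap.id (cofreeCoact V x) =
      cofreeCoact W (BTensor.map k f LinearMap.id x)
    induction x using induction_on with
    | zero => simp
    | tmul v c => exact map_map _ _ _ _ _
    | add x y hx hy => simp only [map_add, hx, hy]⟩

/-- The coaction, as a comodule morphism to a cofree comodule. -/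
def toCofree (X : RightComod k A C) : X ⟶ cofree X.carrier :=
  ⟨X.coact, fun x => by
    apply assoc_injective
    exact (X.coassoc x).trans (assoc_assocInv _).symm⟩

end Cofree

/-- In a locally noetherian category of comodules, finitely generated comodules are finitely
presented modules. -/
theorem ker_fg (hC : LeftFlat k A C) (hN : IsLocallyNoetherian (RightComod k A C))
    {X : RightComod k A C} (hX : finitelyGenerated _ X)
    {V : Type u} [AddCommGroup V] [Module k V] [Module Aᵐᵒᵖ V] [IsScalarTower k Aᵐᵒᵖ V]
    [Module.Finite Aᵐᵒᵖ V] (π : V →ₗ[Aᵐᵒᵖ] X.carrier) (hπ : Function.Surjective π) :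
    (LinearMap.ker π).FG := by
  have hU := comodLike (k := k) (A := A) hC
  let f : (cofree V : RightComod k A C) ⟶ cofree X.carrier := cofreeMap π
  have hf : Function.Surjective (lin (forget k A C) f) :=
    map_surjective hπ Function.surjective_id
  -- The coaction maps `X` onto a noetherian subcomodule of `X ⊗ C`; `P` is a noetherian subcomodule
  -- of `V ⊗ C` lying over it.
  obtain ⟨P, hP, hPT⟩ := hU.exists_map_eq hN f
    ⟨isSub_range (toCofree X), hU.chainCondition_range _ ((hU.finitelyGenerated_iff hN X).1 hX)⟩
    (by rw [LinearMap.range_eq_top.2 hf]; exact le_top)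
  let I : Submodule Aᵐᵒᵖ V → Submodule Aᵐᵒᵖ (BTensor k A V C) :=
    fun K => LinearMap.range (mapRight (C := C) k K.subtype)
  have hI : ∀ K, IsSub (forget k A C) (X := cofree V) (I K) := fun K =>
    isSub_range (cofreeMap K.subtype)
  have hImono : Monotone I := fun K K' h => by
    rintro _ ⟨x, rfl⟩
    exact ⟨BTensor.map k (Submodule.inclusion h) LinearMap.id x, map_map _ _ _ _ _⟩
  -- The kernel of `f` is the image of `ker π ⊗ C`, hence the directed union of the images of `K ⊗
  -- C` for finitely generated `K ≤ ker π`. The noetherian intersection of `P` with the kernel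
  -- therefore lies in one of them.
  let s : Set (Submodule Aᵐᵒᵖ (BTensor k A V C)) := I '' {K | K ≤ LinearMap.ker π ∧ K.FG}
  have hmem : ∀ z : BTensor k A (LinearMap.ker π) C,
      BTensor.map k (LinearMap.ker π).subtype LinearMap.id z ∈ sSup s := by
    intro z
    induction z using induction_on with
    | zero => rw [map_zero]; exact zero_mem _
    | tmul v c =>
      have hv : I (Aᵐᵒᵖ ∙ (v : V)) ∈ s :=
        ⟨_, ⟨(Submodule.span_singleton_le_iff_mem _ _).2 v.2, Submodule.fg_span_singleton _⟩, rfl⟩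
      exact le_sSup hv ⟨BTensor.tmul k A ⟨v, Submodule.mem_span_singleton_self _⟩ c, rfl⟩
    | add x y hx hy => rw [map_add]; exact add_mem hx hy
  have hle : P ⊓ LinearMap.ker (lin (forget k A C) f) ≤ sSup s := fun y hy => by
    obtain ⟨z, rfl⟩ := exact_map_left C hπ (Submodule.range_subtype _).ge hy.2
    exact hmem z
  have hker : IsSub (forget k A C) (LinearMap.ker (lin (forget k A C) f)) := by
    obtain ⟨K, i, -, hi⟩ := hU.exists_kernel f
    exact ⟨K, i, hi⟩
  obtain ⟨_, ⟨K, ⟨hK, hKfg⟩, rfl⟩, hPK⟩ := hU.exists_le_of_le_sSup (s := s)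
    ⟨hU.isSub_inf hP.1 hker, hP.2.mono inf_le_left⟩ ⟨_, ⊥, ⟨bot_le, Submodule.fg_bot⟩, rfl⟩
    (by
      rintro _ ⟨K, hK, rfl⟩ _ ⟨K', hK', rfl⟩
      exact ⟨_, ⟨K ⊔ K', ⟨sup_le hK.1 hK'.1, hK.2.sup hK'.2⟩, rfl⟩,
        hImono le_sup_left, hImono le_sup_right⟩)
    (by rintro _ ⟨K, -, rfl⟩; exact hI K) hle
  let ε := (Coring.counit (k := k) (A := A) (C := C)).left
  let εV : BTensor k A V C →ₗ[Aᵐᵒᵖ] V := contractRightHom (C := C) k ε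
    (Coring.counit (k := k) (A := A) (C := C)).map_op_smul
  have hπε : ∀ (x : X.carrier) (y : BTensor k A V C),
      BTensor.map k π LinearMap.id y = X.coact x → π (εV y) = x := fun x y hxy => by
    have := contractRight_map π LinearMap.id ε y
    rw [hxy, X.counit] at this
    exact this.symm
  -- `W` is chosen so that `W + ker π = V` and `W ∩ ker π = K`. Then `ker π / K ≅ V / W` is finitely
  -- generated, and so is `ker π`.
  let W : Submodule Aᵐᵒᵖ V := Submodule.map εV P ⊔ K
  have hW₁ : LinearMap.ker π ⊓ W = K := by
    refine le_antisymm ?_ (le_inf hK le_sup_right)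
    rintro w ⟨hw, hw'⟩
    obtain ⟨_, ⟨y, hy, rfl⟩, κ, hκ, rfl⟩ := Submodule.mem_sup.1 hw'
    refine add_mem ?_ hκ
    have hκ' : π κ = 0 := hK hκ
    have hw₀ : π (εV y + κ) = 0 := hw
    rw [map_add, hκ', add_zero] at hw₀
    obtain ⟨x, hx⟩ : lin (forget k A C) f y ∈ LinearMap.range (lin (forget k A C) (toCofree X)) :=
      hPT ▸ Submodule.mem_map_of_mem hy
    -- If `y ∈ P` lies over `ρ(x)` then `π(ε_V(y)) = x`. Here this vanishes, so `y` lies in `P ∩ ker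
    -- f`, hence in the image of `K ⊗ C`, and the counit sends it into `K`.
    have hx₀ : x = 0 := (hπε x y hx.symm).symm.trans hw₀
    obtain ⟨z, rfl⟩ := hPK ⟨hy, show lin (forget k A C) f y = 0 by rw [← hx, hx₀, map_zero]⟩
    have h₁ : εV (mapRight (C := C) k K.subtype z) =
      K.subtype (contractRight (ε ∘ₗ LinearMap.id) z) := contractRight_map _ _ _ _
    exact h₁ ▸ Subtype.property _
  have hW₂ : W ⊔ LinearMap.ker π = ⊤ := by
    refine top_le_iff.1 fun v _ => ?_
    obtain ⟨y, hy, hyv⟩ : lin (forget k A C) (toCofree X) (π v) ∈ P.map (lin (forget k A C) f) :=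
      hPT ▸ ⟨_, rfl⟩
    rw [← add_sub_cancel (εV y) v]
    refine Submodule.add_mem_sup (Submodule.mem_sup_left ⟨y, hy, rfl⟩) ?_
    rw [LinearMap.mem_ker, map_sub, hπε (π v) y hyv, sub_self]
  refine Submodule.fg_of_fg_map_of_fg_inf_ker W.mkQ ?_ ?_
  · have : (LinearMap.ker π).map W.mkQ = ⊤ := by
      rw [← W.range_mkQ, ← Submodule.map_top, ← hW₂, Submodule.map_sup, Submodule.mkQ_map_self, bot_sup_eq]
    rw [this]
    exact Module.Finite.fg_top
  · rwa [Submodule.ker_mkQ, hW₁]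

end RightComod

end

/-! ### The isomorphism between `M □_C N` and `Hom_C(^*N, M)` -/

section

open BTensor

variable {k A : Type u} [CommRing k] [Ring A] [Algebra k A]

section Modules

variable {M : Type u} [AddCommGroup M] [Module k M] [Module Aᵐᵒᵖ M] [IsScalarTower k Aᵐᵒᵖ M]
variable {N : Type u} [AddCommGroup N] [Module k N] [Module A N] [IsScalarTower k A N]
variable {N' : Type u} [AddCommGroup N'] [Module k N'] [Module A N'] [IsScalarTower k A N']
variable {D : Type u} [AddCommGroup D] [Module Aᵐᵒᵖ D]

theorem BTensor.contractRight_add_form (g g' : N →ₗ[A] A) (x : BTensor k A M N) :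
    BTensor.contractRight (g + g') x = BTensor.contractRight g x + BTensor.contractRight g' x := by
  induction x using induction_on with
  | zero => simp
  | tmul m n => simp [add_smul]
  | add x y hx hy => rw [map_add, map_add, map_add, hx, hy]; abel

theorem BTensor.contractRight_smul_form (a : Aᵐᵒᵖ) (g : N →ₗ[A] A) (x : BTensor k A M N) :
    BTensor.contractRight (a • g) x = a • BTensor.contractRight g x := by
  induction x using induction_on with
  | zero => simp
  | tmul m n =>
    simp only [contractRight_tmul, LinearMap.smul_apply, smul_smul]
    rfl
  | add x y hx hy => simp only [map_add, smul_add, hx, hy]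

/-- The canonical map `M ⊗_A N → Hom_A(D, M)` for a module `D` of linear forms on `N`. -/
def tensorToHom (e : D →ₗ[Aᵐᵒᵖ] DualOfLeft A N) (x : BTensor k A M N) : D →ₗ[Aᵐᵒᵖ] M where
  toFun d := BTensor.contractRight (e d) x
  map_add' d d' := by rw [map_add, contractRight_add_form]
  map_smul' a d := by rw [map_smul, contractRight_smul_form]; rfl

theorem tensorToHom_apply (e : D →ₗ[Aᵐᵒᵖ] DualOfLeft A N) (x : BTensor k A M N) (d : D) :
    tensorToHom e x d = BTensor.contractRight (e d) x := rfl

variable (e : D →ₗ[Aᵐᵒᵖ] DualOfLeft A N) {n : ℕ} (p : (Fin n → A) →ₗ[Aᵐᵒᵖ] D)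

/-- The forms on `N` given by generators of `D`. -/
def generatorForm (i : Fin n) : N →ₗ[A] A := e (p (Pi.single i 1))

theorem hom_ext_single {P : Type u} [AddCommGroup P] [Module Aᵐᵒᵖ P]
    {f g : (Fin n → A) →ₗ[Aᵐᵒᵖ] P} (h : ∀ i, f (Pi.single i 1) = g (Pi.single i 1)) : f = g :=
  LinearMap.pi_ext' fun i => LinearMap.ext_ring_op (h i)

variable {e p}

/-- Elements of `N` are separated by the forms in `D`, and evaluation at an element of `N` is linear
on `D`, so generators of `D` suffice. -/
theorem generatorForm_injective (hp : Function.Surjective p)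
    (he : Function.Injective fun n : N => evalLeft n ∘ₗ e) :
    Function.Injective (LinearMap.pi (generatorForm e p)) := by
  intro x y hxy
  refine he (LinearMap.ext fun d => ?_)
  obtain ⟨v, rfl⟩ := hp d
  exact LinearMap.congr_fun (hom_ext_single (f := (evalLeft x ∘ₗ e) ∘ₗ p)
    (g := (evalLeft y ∘ₗ e) ∘ₗ p) fun i => congrFun hxy i) v

/-- The left linear map `a ↦ (∑ i, a i * κ j i)` defined by vectors `κ j`. -/
def relationMap {q : ℕ} (κ : Fin q → Fin n → A) : (Fin n → A) →ₗ[A] (Fin q → A) where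
  toFun a j := ∑ i, a i * κ j i
  map_add' a b := by ext j; simp [add_mul, Finset.sum_add_distrib]
  map_smul' r a := by ext j; simp [Finset.mul_sum, mul_assoc]

/-- Dualising the presentation of `D` is exact: a vector `a` killing the relations defines a form on
`A^n` that descends to `D`, and every form on `D` is evaluation at an element of `N`. -/
theorem ker_relationMap_le (hp : Function.Surjective p) {q : ℕ} {κ : Fin q → Fin n → A}
    (hκ : Submodule.span Aᵐᵒᵖ (Set.range κ) = LinearMap.ker p)
    (he : Function.Surjective fun n : N => evalLeft n ∘ₗ e) :
    LinearMap.ker (relationMap κ) ≤ LinearMap.range (LinearMap.pi (generatorForm e p)) := by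
  intro a ha
  let ev : (Fin n → A) →ₗ[Aᵐᵒᵖ] A :=
    { toFun := fun v => ∑ i, a i * v i
      map_add' := fun v w => by simp [mul_add, Finset.sum_add_distrib]
      map_smul' := fun r v => by simp [Finset.sum_mul, mul_assoc] }
  have hev : LinearMap.ker p ≤ LinearMap.ker ev := by
    rw [← hκ, Submodule.span_le]
    rintro _ ⟨j, rfl⟩
    exact congrFun ha j
  let δ : D →ₗ[Aᵐᵒᵖ] A := (LinearMap.ker p).liftQ ev hev ∘ₗ
    (LinearMap.quotKerEquivOfSurjective p hp).symm.toLinearMap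
  have hδ : ∀ v, δ (p v) = ev v := fun v => by
    have : (LinearMap.quotKerEquivOfSurjective p hp).symm (p v) = (LinearMap.ker p).mkQ v := by
      rw [LinearEquiv.symm_apply_eq]; rfl
    exact congrArg ((LinearMap.ker p).liftQ ev hev) this
  obtain ⟨y, hy⟩ := he δ
  refine ⟨y, funext fun i => ?_⟩
  refine (LinearMap.congr_fun hy (p (Pi.single i 1))).trans ((hδ _).trans ?_)
  change ∑ i', a i' * (Pi.single i 1 : Fin n → A) i' = a i
  simp [Pi.single_apply]

variable (k) in
/-- The element of `M ⊗_A A^n` with given coordinates. -/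
def vectorTensor (m : Fin n → M) : BTensor k A M (Fin n → A) :=
  ∑ i, BTensor.tmul k A (m i) (Pi.single i 1 : Fin n → A)

theorem contractRight_vectorTensor (m : Fin n → M) (g : (Fin n → A) →ₗ[A] A) :
    BTensor.contractRight g (vectorTensor k m) = ∑ i, op (g (Pi.single i 1)) • m i := by
  simp only [vectorTensor, map_sum, contractRight_tmul]

/-- The coordinates of the image are the relations evaluated on the vector `m`. -/
theorem map_relationMap_vectorTensor {q : ℕ} {κ : Fin q → Fin n → A} {m : Fin n → M}
    (h : ∀ j, ∑ i, op (κ j i) • m i = 0) :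
    BTensor.map k LinearMap.id (relationMap κ) (vectorTensor k m) = 0 := by
  refine eq_zero_of_map_proj_eq_zero fun j => contractRight_id_injective ?_
  rw [map_zero, map_map, contractRight_map, contractRight_vectorTensor]
  refine (Finset.sum_congr rfl fun i _ => ?_).trans (h j)
  congr 2
  simp [relationMap, Pi.single_apply]

theorem tensorToHom_eq (hp : Function.Surjective p) {x : BTensor k A M N} {f : D →ₗ[Aᵐᵒᵖ] M}
    (h : ∀ i, BTensor.contractRight (generatorForm e p i) x = f (p (Pi.single i 1))) :
    tensorToHom e x = f := by
  ext d
  obtain ⟨v, rfl⟩ := hp d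
  exact LinearMap.congr_fun (hom_ext_single (f := tensorToHom e x ∘ₗ p) (g := f ∘ₗ p) h) v

/-- `M ⊗_A N → Hom_A(D, M)` is surjective if `M` is flat, `D` is finitely presented and
`N` is the dual of `D`. -/
theorem tensorToHom_surjective (hM : RightFlat k A M) (hp : Function.Surjective p)
    (hpfg : (LinearMap.ker p).FG) (he : Function.Bijective fun n : N => evalLeft n ∘ₗ e)
    (f : D →ₗ[Aᵐᵒᵖ] M) : ∃ x : BTensor k A M N, tensorToHom e x = f := by
  obtain ⟨q, κ, hκ⟩ := Submodule.fg_iff_exists_fin_generating_family.1 hpfg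
  have hφ := generatorForm_injective hp he.1
  have hc := ker_relationMap_le hp hκ he.2
  -- The values of `f` on the generators of `D` satisfy the relations of `D`, so they form a vector
  -- in the kernel of `M ⊗ relationMap κ`.
  have hker : ∀ j, ∑ i, op (κ j i) • f (p (Pi.single i 1)) = 0 := fun j => by
    have hκ₀ : p (κ j) = 0 := hκ.le (Submodule.subset_span ⟨j, rfl⟩)
    have h : κ j = ∑ i, op (κ j i) • (Pi.single i 1 : Fin n → A) := by
      ext l; simp [Pi.single_apply]
    have h' := congrArg (fun v => f (p v)) h
    simp only [hκ₀, map_zero, map_sum, map_smul] at h'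
    exact h'.symm
  -- Flatness lifts this vector to `M ⊗ ker (relationMap κ)`. That kernel lies in the image of `N`
  -- in `A^n`, so `r` transports the lift to `M ⊗ N`.
  obtain ⟨z, hz⟩ := hM.exists_of_map_eq_zero (relationMap κ)
    (map_relationMap_vectorTensor (k := k) hker)
  obtain ⟨r, hr⟩ : ∃ r : LinearMap.ker (relationMap κ) →ₗ[A] N,
      LinearMap.pi (generatorForm e p) ∘ₗ r = (LinearMap.ker (relationMap κ)).subtype :=
    ⟨(LinearEquiv.ofInjective _ hφ).symm.toLinearMap ∘ₗ Submodule.inclusion hc,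
      LinearMap.ext fun a => congrArg Subtype.val
        ((LinearEquiv.ofInjective _ hφ).apply_symm_apply (Submodule.inclusion hc a))⟩
  refine ⟨BTensor.map k LinearMap.id r z, tensorToHom_eq hp fun i => ?_⟩
  have h₁ : LinearMap.proj i ∘ₗ LinearMap.pi (generatorForm e p) = generatorForm e p i := rfl
  have h₂ : BTensor.map k (LinearMap.id : M →ₗ[Aᵐᵒᵖ] M) (LinearMap.pi (generatorForm e p))
      (BTensor.map k LinearMap.id r z) =
        vectorTensor k (fun i => f (p (Pi.single i 1))) := by
    rw [map_map, hr, LinearMap.id_comp]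
    exact hz
  have h₃ := contractRight_map (k := k) (LinearMap.id : M →ₗ[Aᵐᵒᵖ] M)
    (LinearMap.pi (generatorForm e p)) (LinearMap.proj i) (BTensor.map k LinearMap.id r z)
  rw [h₂, contractRight_vectorTensor, LinearMap.id_apply, h₁] at h₃
  rw [← h₃, Finset.sum_eq_single i]
  · simp
  · intro j _ hj
    simp [hj.symm]
  · simp

end Modules

section Comodules

variable {C : Type u} [AddCommGroup C] [Module k C]
    [Module A C] [Module Aᵐᵒᵖ C] [SMulCommClass A Aᵐᵒᵖ C] [IsScalarTower k A C]
    [IsScalarTower k Aᵐᵒᵖ C] [Coring k A C]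

variable (k C) in
/-- The contraction `C ⊗_A N → C` as a left linear map. -/
def contractRightLeftHom {N : Type u} [AddCommGroup N] [Module k N] [Module A N]
    [IsScalarTower k A N] (g : N →ₗ[A] A) : BTensor k A C N →ₗ[A] C where
  toFun := BTensor.contractRight g
  map_add' := map_add _
  map_smul' := contractRight_smul g

variable (M : RightComod k A C) (N : LeftComod k A C) {D : RightComod k A C}
  (e : D.carrier ≃ₗ[Aᵐᵒᵖ] DualOfLeft A N.carrier)

theorem map_contract_assoc (d : N.carrier →ₗ[A] A) (x : BTensor k A M.carrier N.carrier) :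
    BTensor.map k LinearMap.id (contractRightLeftHom k C d)
      (assoc (BTensor.map k M.coact LinearMap.id x)) = M.coact (BTensor.contractRight d x) := by
  induction x using induction_on with
  | zero => simp
  | tmul m n =>
    rw [contractRight_tmul, map_smul, map_tmul]
    generalize M.coact m = y
    induction y using induction_on with
    | zero => simp
    | tmul m c => rfl
    | add x y hx hy => rw [add_tmul, map_add, map_add, hx, hy, smul_add]
  | add x y hx hy => simp only [map_add, hx, hy]

/-- On elementary tensors this is the defining property of the coaction of `^*N`, with the scalar `e
d n` moved across the tensor sign. -/
theorem map_contract_coact (he : IsDualOfLeft N D e) (d : D.carrier)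
    (x : BTensor k A M.carrier N.carrier) :
    BTensor.map k LinearMap.id (contractRightLeftHom k C (e d))
      (BTensor.map k LinearMap.id N.coact x) =
        BTensor.map k (tensorToHom e.toLinearMap x) LinearMap.id (D.coact d) := by
  induction x using induction_on with
  | zero =>
    have : tensorToHom (k := k) (M := M.carrier) e.toLinearMap 0 = 0 :=
      LinearMap.ext fun d => map_zero (BTensor.contractRight (k := k) (M := M.carrier) (e d))
    rw [this, map_zero_left, map_zero, map_zero]; rfl
  | tmul m n =>
    rw [map_tmul, map_tmul]
    refine (congrArg (BTensor.tmul k A m) (he d n).symm).trans ?_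
    generalize D.coact d = y
    induction y using induction_on with
    | zero => simp
    | tmul d c => exact (op_smul_tmul k A m (e d n) c).symm
    | add x y hx hy => rw [map_add, tmul_add, hx, hy, map_add]
  | add x y hx hy =>
    have : tensorToHom e.toLinearMap (x + y) =
        tensorToHom e.toLinearMap x + tensorToHom e.toLinearMap y :=
      LinearMap.ext fun d => map_add (BTensor.contractRight (k := k) (M := M.carrier) (e d)) x y
    rw [this, map_add_left, map_add, map_add, hx, hy]; rfl

/-- The right side is the defect of colinearity at `d`: the kernel condition of the cotensor product
is colinearity, seen through contraction. -/
theorem map_contract_omega (he : IsDualOfLeft N D e) (d : D.carrier)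
    (x : BTensor k A M.carrier N.carrier) :
    BTensor.map k LinearMap.id (contractRightLeftHom k C (e d)) (omega M N x) =
      M.coact (tensorToHom e.toLinearMap x d) -
        BTensor.map k (tensorToHom e.toLinearMap x) LinearMap.id (D.coact d) := by
  rw [← map_contract_coact M N e he, tensorToHom_apply]
  refine Eq.trans ?_ (congrArg (fun z => z - _) (map_contract_assoc M N (e d) x))
  exact map_sub _ _ _

variable {M N e} {n : ℕ} {p : (Fin n → A) →ₗ[Aᵐᵒᵖ] D.carrier}

/-- Flatness of `M` and `C` lets the contractions by generators of `D` detect zero in `M ⊗ C ⊗ N`,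
so a vanishing colinearity defect forces `ω(x) = 0`. -/
theorem omega_eq_zero_iff (hM : RightFlat k A M.carrier) (hC : RightFlat k A C)
    (hp : Function.Surjective p) (he : IsDualOfLeft N D e)
    (he' : Function.Injective fun n : N.carrier => evalLeft n ∘ₗ e.toLinearMap)
    (x : BTensor k A M.carrier N.carrier) :
    omega M N x = 0 ↔ tensorToHom e.toLinearMap x ∈ RightComod.homs D M := by
  constructor
  · intro h d
    have := map_contract_omega M N e he d x
    rw [h, map_zero, eq_comm, sub_eq_zero] at this
    exact this.symm
  · intro h
    refine eq_zero_of_map_contractRight_eq_zero hM hC _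
      (generatorForm_injective (e := e.toLinearMap) hp he')
      (fun i => contractRightLeftHom k C (generatorForm e.toLinearMap p i)) (fun _ _ => rfl)
      fun i => ?_
    refine (map_contract_omega M N e he (p (Pi.single i 1)) x).trans ?_
    rw [sub_eq_zero]
    exact (h _).symm

/-- The isomorphism `M □_C N ≅ Hom_C(^*N, M)`. -/
theorem tensorToHom_bijOn (hM : RightFlat k A M.carrier) (hC : RightFlat k A C)
    (hp : Function.Surjective p) (hpfg : (LinearMap.ker p).FG) (he : IsDualOfLeft N D e)
    (he' : Function.Bijective fun n : N.carrier => evalLeft n ∘ₗ e.toLinearMap) :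
    Set.BijOn (tensorToHom e.toLinearMap)
      (LinearMap.ker (omega M N) : Set (BTensor k A M.carrier N.carrier))
      (RightComod.homs D M : Set (D.carrier →ₗ[Aᵐᵒᵖ] M.carrier)) := by
  refine ⟨fun x hx => (omega_eq_zero_iff hM hC hp he he'.1 x).1 hx, ?_, ?_⟩
  · intro x _ y _ hxy
    rw [← sub_eq_zero]
    refine eq_zero_of_contractRight_eq_zero hM _
      (generatorForm_injective (e := e.toLinearMap) hp he'.1) fun i => ?_
    rw [map_sub, sub_eq_zero]
    exact LinearMap.congr_fun hxy _
  · intro f hf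
    obtain ⟨x, rfl⟩ := tensorToHom_surjective (k := k) hM hp hpfg he' f
    exact ⟨x, (omega_eq_zero_iff hM hC hp he he'.1 x).2 hf, rfl⟩

end Comodules

end

/-! ### Reduction of coflatness, injectivity and faithfulness to finitely generated comodules -/

section

section FinitelyGenerated

variable {R : Type u} [Ring R] {𝒳 : Type (u + 1)} [Category.{u} 𝒳] [Preadditive 𝒳]
  {U : 𝒳 ⥤ ModuleCat.{u} R} [U.Additive] [U.Faithful]

/-- The finitely generated objects of a locally noetherian category are closed under kernels and
cokernels. -/
theorem ComodLike.hasConcreteKernels_fg (hU : ComodLike U) (hN : IsLocallyNoetherian 𝒳) :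
    HasConcreteKernels ((finitelyGenerated 𝒳).ι ⋙ U) where
  lift i g hi hle := by
    obtain ⟨h, hh⟩ := hU.lift i.hom g.hom hi hle
    exact ⟨ObjectProperty.homMk h, ObjectProperty.hom_ext _ hh⟩
  desc p g hp hle := by
    obtain ⟨h, hh⟩ := hU.desc p.hom g.hom hp hle
    exact ⟨ObjectProperty.homMk h, ObjectProperty.hom_ext _ hh⟩
  exists_kernel {X Y} f := by
    obtain ⟨K, i, hi, hi'⟩ := hU.exists_kernel f.hom
    exact ⟨⟨K, hU.finitelyGenerated_of_injective hN i hi X.property⟩,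
      ObjectProperty.homMk i, hi, hi'⟩
  exists_cokernel {X Y} f := by
    obtain ⟨Q, p, hp, hp'⟩ := hU.exists_cokernel f.hom
    exact ⟨⟨Q, hU.finitelyGenerated_of_surjective hN p hp Y.property⟩,
      ObjectProperty.homMk p, hp, hp'⟩

/-- Equality of morphisms can be tested on finitely generated subobjects. -/
theorem ComodLike.eq_of_fg (hU : ComodLike U) (hN : IsLocallyNoetherian 𝒳) {X Y : 𝒳}
    (f f' : X ⟶ Y)
    (H : ∀ (E F : (finitelyGenerated 𝒳).FullSubcategory) (i : E.obj ⟶ X) (l : F.obj ⟶ Y)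
      (a a' : E ⟶ F), Function.Injective (lin U l) → a.hom ≫ l = i ≫ f → a'.hom ≫ l = i ≫ f' →
        a = a') : f = f' := by
  refine lin_injective (U := U) (LinearMap.ext fun x => ?_)
  obtain ⟨S, hS, hx⟩ := hU.exists_mem_noetherianSubs hN x
  obtain ⟨E, i, hE, hi, rfl⟩ := hU.exists_finitelyGenerated_of_mem hN hS
  obtain ⟨x, rfl⟩ := hx
  have hE' := (hU.finitelyGenerated_iff hN E).1 hE
  have hT : ∀ g : E ⟶ Y, LinearMap.range (lin U g) ∈ noetherianSubs U Y := fun g =>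
    ⟨isSub_range g, hU.chainCondition_range g hE'⟩
  -- `F` contains the images of `E` under both morphisms, so both restrictions live between finitely
  -- generated objects.
  obtain ⟨F, l, hF, hl, hFl⟩ := hU.exists_finitelyGenerated_of_mem hN
    (hU.noetherianSubs_sup (hT (i ≫ f)) (hT (i ≫ f')))
  obtain ⟨a, ha⟩ := hU.lift l (i ≫ f) hl (hFl ▸ le_sup_left)
  obtain ⟨a', ha'⟩ := hU.lift l (i ≫ f') hl (hFl ▸ le_sup_right)
  have := H ⟨E, hE⟩ ⟨F, hF⟩ i l (ObjectProperty.homMk a) (ObjectProperty.homMk a') hl ha ha'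
  have haa' : a = a' := congrArg (fun h => h.hom) this
  rw [← lin_comp_apply, ← lin_comp_apply, ← ha, ← ha', haa']

theorem moduleCat_shortExact_iff (S : ShortComplex (ModuleCat.{u} R)) :
    S.ShortExact ↔ Function.Injective S.f.hom ∧
      (∀ x, S.g.hom x = 0 → ∃ y, S.f.hom y = x) ∧ Function.Surjective S.g.hom := by
  constructor
  · intro h
    exact ⟨(ModuleCat.mono_iff_injective _).1 h.mono_f,
      (ShortComplex.moduleCat_exact_iff S).1 h.exact, (ModuleCat.epi_iff_surjective _).1 h.epi_g⟩
  · rintro ⟨h₁, h₂, h₃⟩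
    have := (ModuleCat.mono_iff_injective S.f).2 h₁
    have := (ModuleCat.epi_iff_surjective S.g).2 h₃
    exact .mk ((ShortComplex.moduleCat_exact_iff S).2 h₂)

end FinitelyGenerated

variable {k A C : Type u} [CommRing k] [Ring A] [Algebra k A] [AddCommGroup C] [Module k C]
    [Module A C] [Module Aᵐᵒᵖ C] [SMulCommClass A Aᵐᵒᵖ C] [IsScalarTower k A C]
    [IsScalarTower k Aᵐᵒᵖ C] [Coring k A C]

section Cotensor

open BTensor

variable {M : RightComod k A C}

theorem map_linearMap_comp {L N P : LeftComod k A C} (f : L ⟶ N) (g : N ⟶ P)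
    (x : BTensor k A M.carrier L.carrier) :
    BTensor.map k LinearMap.id (LeftComod.linearMap (f ≫ g)) x =
      BTensor.map k (LinearMap.id : M.carrier →ₗ[Aᵐᵒᵖ] _) (LeftComod.linearMap g)
        (BTensor.map k LinearMap.id (LeftComod.linearMap f) x) := by
  rw [map_map, LinearMap.id_comp]
  rfl

theorem omega_map_eq_zero {N N' : LeftComod k A C} (f : N ⟶ N')
    {x : BTensor k A M.carrier N.carrier} (hx : omega M N x = 0) :
    omega M N' (BTensor.map k LinearMap.id (LeftComod.linearMap f) x) = 0 := by
  rw [omega_naturality, hx, map_zero]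

/-- By flatness of `C` and then of `M`, the target `M ⊗ C ⊗ N` of `ω` embeds in `M ⊗ C ⊗ N'`. -/
theorem omega_eq_zero_of_map (hM : RightFlat k A M.carrier) (hC : RightFlat k A C)
    {N N' : LeftComod k A C} (f : N ⟶ N') (hf : Function.Injective (LeftComod.linearMap f))
    {x : BTensor k A M.carrier N.carrier}
    (hx : omega M N' (BTensor.map k LinearMap.id (LeftComod.linearMap f) x) = 0) :
    omega M N x = 0 := by
  rw [omega_naturality] at hx
  refine hM _ _ _ ?_ (hx.trans (map_zero _).symm)
  exact hC _ _ (LeftComod.linearMap f) hf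

theorem exists_map_eq_of_le_range {M N N' : Type u} [AddCommGroup M] [Module k M] [Module Aᵐᵒᵖ M]
    [IsScalarTower k Aᵐᵒᵖ M] [AddCommGroup N] [Module k N] [Module A N] [IsScalarTower k A N]
    [AddCommGroup N'] [Module k N'] [Module A N'] [IsScalarTower k A N'] (i : N →ₗ[A] N')
    (hi : Function.Injective i) {S : Submodule A N'} (hS : S ≤ LinearMap.range i)
    (y : BTensor k A M S) : ∃ z : BTensor k A M N,
      BTensor.map k LinearMap.id i z = BTensor.map k LinearMap.id S.subtype y := by
  obtain ⟨r, hr⟩ : ∃ r : S →ₗ[A] N, i ∘ₗ r = S.subtype :=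
    ⟨(LinearEquiv.ofInjective i hi).symm.toLinearMap ∘ₗ Submodule.inclusion hS,
      LinearMap.ext fun a => congrArg Subtype.val
        ((LinearEquiv.ofInjective i hi).apply_symm_apply (Submodule.inclusion hS a))⟩
  exact ⟨BTensor.map k LinearMap.id r y, by rw [map_map, hr]; rfl⟩

variable (M) in
/-- `M □_C -` maps `g` to a surjective map. -/
def CotensorSurjective {N N' : LeftComod k A C} (g : N ⟶ N') : Prop :=
  ∀ x : BTensor k A M.carrier N'.carrier, omega M N' x = 0 →
    ∃ y, omega M N y = 0 ∧ BTensor.map k LinearMap.id (LeftComod.linearMap g) y = x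

theorem cotensorSurjective_iff {N N' : LeftComod k A C} (g : N ⟶ N') :
    CotensorSurjective M g ↔ Function.Surjective ((cotensor M).map g).hom := by
  constructor
  · intro h x
    obtain ⟨y, hy, hyx⟩ := h x.1 x.2
    exact ⟨⟨y, hy⟩, Subtype.ext hyx⟩
  · intro h x hx
    obtain ⟨y, hy⟩ := h ⟨x, hx⟩
    exact ⟨y.1, y.2, congrArg Subtype.val hy⟩

/-- Flatness of `M` and `C` makes `M □_C -` left exact, so only preservation of surjections is at
stake. -/
theorem coflat_iff (hM : RightFlat k A M.carrier) (hC : RightFlat k A C) :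
    Coflat M ↔ ∀ {N N' : LeftComod k A C} (g : N ⟶ N'),
      Function.Surjective (LeftComod.linearMap g) → CotensorSurjective M g := by
  have hU := LeftComod.comodLike (k := k) (A := A) hC
  constructor
  · intro h N N' g hg
    obtain ⟨K, i, hi, hi'⟩ := hU.exists_kernel g
    have hS := h (.mk i g (comp_eq_zero_iff.2 hi'.le)) ((hU.shortExact_iff _).2 ⟨hi, hi', hg⟩)
    exact (cotensorSurjective_iff g).2 ((moduleCat_shortExact_iff _).1 hS).2.2
  · intro h S hS
    obtain ⟨hf, hfg, hg⟩ := (hU.shortExact_iff S).1 hS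
    refine (moduleCat_shortExact_iff _).2 ⟨?_, ?_, (cotensorSurjective_iff _).1 (h S.g hg)⟩
    · intro x y hxy
      exact Subtype.ext (hM _ _ (LeftComod.linearMap S.f) hf (congrArg Subtype.val hxy))
    · intro x hx
      obtain ⟨y, hy⟩ := hM.exists_of_map_eq_zero (LeftComod.linearMap S.g) (congrArg Subtype.val hx)
      obtain ⟨z, hz⟩ := exists_map_eq_of_le_range (LeftComod.linearMap S.f) hf hfg.ge y
      have hzx := hz.trans hy
      exact ⟨⟨z, omega_eq_zero_of_map hM hC S.f hf (hzx.symm ▸ x.2)⟩, Subtype.ext hzx⟩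

/-- A tensor involves finitely many elements of `N`, each in a noetherian subcomodule, and finite
sums of these are noetherian. -/
theorem exists_fg_tensor (hC : RightFlat k A C) (hN : IsLocallyNoetherian (LeftComod k A C))
    (N : LeftComod k A C) (x : BTensor k A M.carrier N.carrier) :
    ∃ (F : LeftComod k A C) (i : F ⟶ N), finitelyGenerated _ F ∧
      Function.Injective (LeftComod.linearMap i) ∧
      ∃ y, BTensor.map k LinearMap.id (LeftComod.linearMap i) y = x := by
  have hU := LeftComod.comodLike (k := k) (A := A) hC
  have key : ∃ S : Submodule A N.carrier, S ∈ noetherianSubs (LeftComod.forget k A C) N ∧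
      ∃ y, BTensor.map k (LinearMap.id : M.carrier →ₗ[Aᵐᵒᵖ] _) S.subtype y = x := by
    induction x using induction_on with
    | zero => exact ⟨⊥, ⟨hU.isSub_bot N, hU.chainCondition_bot N⟩, 0, map_zero _⟩
    | tmul m n =>
      obtain ⟨S, hS, hn⟩ : ∃ S : Submodule A N.carrier,
          S ∈ noetherianSubs (LeftComod.forget k A C) N ∧ n ∈ S :=
        hU.exists_mem_noetherianSubs hN (X := N) n
      exact ⟨S, hS, BTensor.tmul k A m (⟨n, hn⟩ : S), rfl⟩
    | add x y hx hy =>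
      obtain ⟨S, hS, x, rfl⟩ := hx
      obtain ⟨T, hT, y, rfl⟩ := hy
      refine ⟨S ⊔ T, hU.noetherianSubs_sup hS hT,
        BTensor.map k LinearMap.id (Submodule.inclusion le_sup_left) x +
          BTensor.map k LinearMap.id (Submodule.inclusion le_sup_right) y, ?_⟩
      rw [map_add, map_map, map_map]
      rfl
  obtain ⟨S, hS, y, rfl⟩ := key
  obtain ⟨F, i, hF, hi, hr⟩ := hU.exists_finitelyGenerated_of_mem hN hS
  exact ⟨F, i, hF, hi, exists_map_eq_of_le_range (LeftComod.linearMap i) hi hr.ge y⟩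

theorem cotensorSurjective_of_fg (hM : RightFlat k A M.carrier) (hC : RightFlat k A C)
    (hN : IsLocallyNoetherian (LeftComod k A C))
    (H : ∀ {N N' : LeftComodFg k A C} (g : N ⟶ N'),
      Function.Surjective (LeftComod.linearMap g.hom) → CotensorSurjective M g.hom)
    {N N' : LeftComod k A C} (g : N ⟶ N') (hg : Function.Surjective (LeftComod.linearMap g)) :
    CotensorSurjective M g := by
  have hU := LeftComod.comodLike (k := k) (A := A) hC
  intro x hx
  obtain ⟨F, i, hF, hi, y, rfl⟩ := exists_fg_tensor hC hN N' x
  have hy := omega_eq_zero_of_map hM hC i hi hx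
  -- The element comes from `M □_C F` with `F` finitely generated. Some finitely generated
  -- subcomodule of `N` maps onto `F`, which reduces the problem to the induced map `h`.
  obtain ⟨S, hS, hSi⟩ := hU.exists_map_eq hN g
    ⟨isSub_range i, hU.chainCondition_range i ((hU.finitelyGenerated_iff hN F).1 hF)⟩
    (le_top.trans_eq (LinearMap.range_eq_top.2 hg).symm)
  obtain ⟨E, j, hE, hj, rfl⟩ := hU.exists_finitelyGenerated_of_mem hN hS
  rw [← LinearMap.range_comp, ← lin_comp] at hSi
  obtain ⟨h, hh⟩ := hU.lift i (j ≫ g) hi hSi.le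
  have hsurj : Function.Surjective (LeftComod.linearMap h) := fun f => by
    obtain ⟨e, he⟩ := hSi.ge ⟨f, rfl⟩
    refine ⟨e, hi ?_⟩
    rw [← hh] at he
    exact he
  obtain ⟨z, hz, hzy⟩ := H (N := ⟨E, hE⟩) (N' := ⟨F, hF⟩) (ObjectProperty.homMk h) hsurj y hy
  refine ⟨_, omega_map_eq_zero j hz, ?_⟩
  rw [← map_linearMap_comp, ← hh, map_linearMap_comp]
  exact congrArg _ hzy

/-- `M □_C -` identifies `f` and `g`. -/
def CotensorEq (M : RightComod k A C) {N N' : LeftComod k A C} (f g : N ⟶ N') : Prop :=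
  ∀ x : BTensor k A M.carrier N.carrier, omega M N x = 0 →
    BTensor.map k LinearMap.id (LeftComod.linearMap f) x =
      BTensor.map k LinearMap.id (LeftComod.linearMap g) x

theorem cotensorEq_iff {N N' : LeftComod k A C} (f g : N ⟶ N') :
    CotensorEq M f g ↔ (cotensor M).map f = (cotensor M).map g := by
  constructor
  · intro h
    exact ModuleCat.hom_ext (LinearMap.ext fun x => Subtype.ext (h x.1 x.2))
  · intro h x hx
    exact congrArg Subtype.val (LinearMap.congr_fun (congrArg ModuleCat.Hom.hom h)
      (⟨x, hx⟩ : LinearMap.ker (omega M N)))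

/-- Restricting to finitely generated subobjects of source and target loses nothing: flatness of `M`
allows the comparison of tensors to be pulled back along the injection `l`. -/
theorem cotensor_faithful_iff (hM : RightFlat k A M.carrier) (hC : RightFlat k A C)
    (hN : IsLocallyNoetherian (LeftComod k A C)) :
    (cotensor M).Faithful ↔ ∀ {N N' : LeftComodFg k A C} (f g : N ⟶ N'),
      CotensorEq M f.hom g.hom → f = g := by
  have hU := LeftComod.comodLike (k := k) (A := A) hC
  constructor
  · intro h N N' f g hfg
    exact ObjectProperty.hom_ext _ ((cotensor M).map_injective ((cotensorEq_iff _ _).1 hfg))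
  · intro H
    refine ⟨fun {N N' f f'} hff' => hU.eq_of_fg hN f f' fun E F i l a a' hl ha ha' => ?_⟩
    refine H a a' fun x hx => hM _ _ (LeftComod.linearMap l) hl ?_
    rw [← map_linearMap_comp, ← map_linearMap_comp, ha, ha', map_linearMap_comp,
      map_linearMap_comp]
    exact (cotensorEq_iff f f').2 hff' _ (omega_map_eq_zero i hx)

end Cotensor

section HomFg

variable {M : RightComod k A C}

/-- Contravariant Hom is left exact; what remains is surjectivity of restriction along a
monomorphism, which is completed to a short exact sequence by its finitely generated cokernel. -/
theorem isExact_homFg_iff (hC : LeftFlat k A C) (hN : IsLocallyNoetherian (RightComod k A C)) :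
    IsExact (homFg M) ↔ ∀ {X Y : RightComodFg k A C} (j : X ⟶ Y),
      Function.Injective (RightComod.linearMap j.hom) →
        ∀ g : X.obj ⟶ M, ∃ h : Y.obj ⟶ M, j.hom ≫ h = g := by
  have hU := RightComod.comodLike (k := k) (A := A) hC
  have hU' := hU.hasConcreteKernels_fg hN
  constructor
  · intro H X Y j hj g
    obtain ⟨Q, q, hq, hq'⟩ := hU'.exists_cokernel j
    have hT : (ShortComplex.mk j q (comp_eq_zero_iff.2 hq'.ge)).ShortExact :=
      (hU'.shortExact_iff _).2 ⟨hj, hq'.symm, hq⟩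
    exact ((moduleCat_shortExact_iff _).1 (H _ hT.op)).2.2 g
  · intro H S hS
    obtain ⟨hf, hfg, hg⟩ := (hU'.shortExact_iff S.unop).1 hS.unop
    refine (moduleCat_shortExact_iff _).2 ⟨?_, ?_, fun g => H S.g.unop hf g⟩
    · intro u v (huv : S.f.unop.hom ≫ u = S.f.unop.hom ≫ v)
      have : Epi S.f.unop.hom := epi_of_lin_surjective (U := RightComod.forget k A C) hg
      exact (cancel_epi S.f.unop.hom).1 huv
    · intro u (hu : S.g.unop.hom ≫ u = 0)
      exact hU.desc S.f.unop.hom u hg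
        (hfg.ge.trans ((comp_eq_zero_iff (U := RightComod.forget k A C)).1 hu))

theorem isExact_homFg_iff_injective (hC : LeftFlat k A C)
    (hN : IsLocallyNoetherian (RightComod k A C)) : IsExact (homFg M) ↔ Injective M := by
  have hU := RightComod.comodLike (k := k) (A := A) hC
  rw [isExact_homFg_iff hC hN]
  constructor
  · intro H
    exact hU.injective_of_extends hN M fun {X Y} hX hY i hi g =>
      H (X := ⟨X, hX⟩) (Y := ⟨Y, hY⟩) (ObjectProperty.homMk i) hi g
  · intro _ X Y j hj g
    have : Mono j.hom := mono_of_lin_injective (U := RightComod.forget k A C) hj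
    exact ⟨Injective.factorThru g j.hom, Injective.comp_factorThru g j.hom⟩

theorem homFg_faithful_iff :
    (homFg M).Faithful ↔ ∀ {X Y : RightComodFg k A C} (j j' : X ⟶ Y),
      (∀ g : Y.obj ⟶ M, j.hom ≫ g = j'.hom ≫ g) → j = j' := by
  constructor
  · intro _ X Y j j' h
    refine Quiver.Hom.op_inj ((homFg M).map_injective ?_)
    exact ModuleCat.hom_ext (LinearMap.ext h)
  · intro H
    refine ⟨fun {X Y f f'} h => Quiver.Hom.unop_inj (H f.unop f'.unop fun g => ?_)⟩
    exact LinearMap.congr_fun (congrArg ModuleCat.Hom.hom h) g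

/-- To pass from finitely generated objects to all objects, a test morphism to `M` on a finitely
generated subobject of `Y` is extended to `Y` by injectivity. -/
theorem homFg_faithful_iff_isCoseparator (hC : LeftFlat k A C)
    (hN : IsLocallyNoetherian (RightComod k A C)) (hM : Injective M) :
    (homFg M).Faithful ↔ IsCoseparator M := by
  have hU := RightComod.comodLike (k := k) (A := A) hC
  rw [homFg_faithful_iff, isCoseparator_def]
  constructor
  · intro H X Y f f' hff'
    refine hU.eq_of_fg hN f f' fun E F i l a a' hl ha ha' => H a a' fun g => ?_
    have : Mono l := mono_of_lin_injective (U := RightComod.forget k A C) hl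
    rw [← Injective.comp_factorThru g l, ← Category.assoc, ← Category.assoc, ha, ha',
      Category.assoc, Category.assoc, hff']
  · intro H X Y j j' h
    exact ObjectProperty.hom_ext _ (H _ _ h)

end HomFg

end

/-! ### Transfer along the duality -/

section

variable {k A C : Type u} [CommRing k] [Ring A] [Algebra k A] [AddCommGroup C] [Module k C]
    [Module A C] [Module Aᵐᵒᵖ C] [SMulCommClass A Aᵐᵒᵖ C] [IsScalarTower k A C]
    [IsScalarTower k Aᵐᵒᵖ C] [Coring k A C]

/-- A finite right module is a quotient of some `A^n`. -/
theorem exists_surjective_of_finite (D : Type u) [AddCommGroup D] [Module Aᵐᵒᵖ D]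
    [Module.Finite Aᵐᵒᵖ D] :
    ∃ (n : ℕ) (p : (Fin n → A) →ₗ[Aᵐᵒᵖ] D), Function.Surjective p := by
  obtain ⟨n, f, hf⟩ := Module.Finite.exists_fin' Aᵐᵒᵖ D
  let c : (Fin n → A) →ₗ[Aᵐᵒᵖ] (Fin n → Aᵐᵒᵖ) :=
    { toFun := fun v i => op (v i)
      map_add' := fun _ _ => rfl
      map_smul' := fun _ _ => rfl }
  exact ⟨n, f ∘ₗ c, hf.comp fun w => ⟨fun i => unop (w i), rfl⟩⟩

theorem finite_vector (n : ℕ) : Module.Finite Aᵐᵒᵖ (Fin n → A) := by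
  let c : (Fin n → Aᵐᵒᵖ) →ₗ[Aᵐᵒᵖ] (Fin n → A) :=
    { toFun := fun v i => unop (v i)
      map_add' := fun _ _ => rfl
      map_smul' := fun _ _ => rfl }
  exact Module.Finite.of_surjective c fun w => ⟨fun i => op (w i), rfl⟩

namespace Duality

variable (d : Duality k A C) {M : RightComod k A C}

/-- The left dual of a finitely generated left comodule. -/
abbrev leftDual (N : LeftComodFg k A C) : RightComodFg k A C := (d.equiv.inverse.obj N).unop

/-- The transpose of a morphism of finitely generated left comodules. -/
abbrev leftDualMap {N N' : LeftComodFg k A C} (h : N ⟶ N') : d.leftDual N' ⟶ d.leftDual N :=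
  (d.equiv.inverse.map h).unop

/-- By `counit_eval` the evaluation map is the counit isomorphism of the equivalence followed by the
identification `dualRight`. -/
theorem evaluation_bijective (hC : HasDuality k A C) (N : LeftComodFg k A C) :
    Function.Bijective fun n : N.obj.carrier => evalLeft n ∘ₗ (d.dualLeft N).toLinearMap := by
  have hU := LeftComod.comodLike (k := k) (A := A) hC.rightFlat
  have h₁ : Function.Bijective
      (LeftComod.linearMap (d.equiv.counitIso.inv.app N).hom) := by
    have : IsIso (d.equiv.counitIso.inv.app N).hom :=
      inferInstanceAs (IsIso ((finitelyGenerated (LeftComod k A C)).ι.map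
        (d.equiv.counitIso.inv.app N)))
    exact ⟨(hU.mono_iff _).1 inferInstance, (hU.epi_iff _).1 inferInstance⟩
  have h₂ := (d.dualRight (d.leftDual N)).bijective.comp h₁
  have h₃ : (fun n : N.obj.carrier => evalLeft n ∘ₗ (d.dualLeft N).toLinearMap) =
      fun n => d.dualRight (d.leftDual N)
        (LeftComod.linearMap (d.equiv.counitIso.inv.app N).hom n) :=
    funext fun n => LinearMap.ext fun x => (d.counit_eval N n x).symm
  rw [h₃]
  exact h₂

theorem bijOn_tensorToHom (hC : HasDuality k A C) (hM : RightFlat k A M.carrier)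
    (N : LeftComodFg k A C) :
    Set.BijOn (tensorToHom (d.dualLeft N).toLinearMap)
      (LinearMap.ker (omega M N.obj) : Set (BTensor k A M.carrier N.obj.carrier))
      (RightComod.homs (d.leftDual N).obj M : Set (_ →ₗ[Aᵐᵒᵖ] M.carrier)) := by
  have := hC.finite_dualLeft N
  have : Module.Finite Aᵐᵒᵖ (d.leftDual N).obj.carrier := Module.Finite.equiv (d.dualLeft N).symm
  obtain ⟨n, p, hp⟩ := exists_surjective_of_finite (A := A) (d.leftDual N).obj.carrier
  have := finite_vector (A := A) n
  -- `^*N` is a finitely generated comodule and a finite module; local noetherianity upgrades this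
  -- to finite presentation.
  have hpfg := RightComod.ker_fg (k := k) hC.leftFlat hC.locallyNoetherian_right
    (d.leftDual N).property p hp
  exact tensorToHom_bijOn hM hC.rightFlat hp hpfg (d.dualLeft_coact N)
    (d.evaluation_bijective hC N)

/-- The comodule morphism `^*N → M` defined by an element of `M □_C N`. -/
theorem exists_hom (hC : HasDuality k A C) (hM : RightFlat k A M.carrier)
    {N : LeftComodFg k A C} {x : BTensor k A M.carrier N.obj.carrier}
    (hx : omega M N.obj x = 0) : ∃ f : (d.leftDual N).obj ⟶ M,
      RightComod.linearMap f = tensorToHom (d.dualLeft N).toLinearMap x :=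
  ⟨⟨_, (d.bijOn_tensorToHom hC hM N).mapsTo hx⟩, rfl⟩

theorem exists_tensor (hC : HasDuality k A C) (hM : RightFlat k A M.carrier)
    {N : LeftComodFg k A C} (f : (d.leftDual N).obj ⟶ M) :
    ∃ x : BTensor k A M.carrier N.obj.carrier, omega M N.obj x = 0 ∧
      RightComod.linearMap f = tensorToHom (d.dualLeft N).toLinearMap x := by
  obtain ⟨x, hx, hxf⟩ := (d.bijOn_tensorToHom hC hM N).surjOn f.2
  exact ⟨x, hx, hxf.symm⟩

/-- Naturality in `N`: under the isomorphism, `M □_C h` becomes precomposition with the transpose of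
`h`. -/
theorem tensorToHom_map {N N' : LeftComodFg k A C} (h : N ⟶ N')
    (x : BTensor k A M.carrier N.obj.carrier) :
    tensorToHom (d.dualLeft N').toLinearMap
      (BTensor.map k LinearMap.id (LeftComod.linearMap h.hom) x) =
        tensorToHom (d.dualLeft N).toLinearMap x ∘ₗ
          RightComod.linearMap (d.leftDualMap h).hom := by
  ext y
  have h₁ := BTensor.contractRight_map (k := k) (LinearMap.id : M.carrier →ₗ[Aᵐᵒᵖ] M.carrier)
    (LeftComod.linearMap h.hom) (d.dualLeft N' y) x
  rw [← d.dualLeft_naturality] at h₁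
  exact h₁

/-- A finitely generated right comodule is isomorphic to its double dual. -/
def doubleDual (X : RightComodFg k A C) :
    X ≅ d.leftDual (d.equiv.functor.obj (Opposite.op X)) :=
  (d.equiv.unitIso.app (Opposite.op X)).unop.symm

theorem doubleDual_naturality {X Y : RightComodFg k A C} (j : X ⟶ Y) :
    j ≫ (d.doubleDual Y).hom =
      (d.doubleDual X).hom ≫ d.leftDualMap (d.equiv.functor.map j.op) :=
  congrArg Quiver.Hom.unop (d.equiv.unitIso.inv.naturality j.op).symm

-- The duality exchanges injections and surjections of finitely generated comodules, and `M □_C N ≅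
-- Hom_C(^*N, M)` turns lifting elements into extending morphisms. Reflexivity ensures that every
-- injection on the right is reached, up to isomorphism.
include d in
theorem cotensorSurjective_iff_extends (hC : HasDuality k A C) (hM : RightFlat k A M.carrier) :
    (∀ {N N' : LeftComodFg k A C} (g : N ⟶ N'),
      Function.Surjective (LeftComod.linearMap g.hom) → CotensorSurjective M g.hom) ↔
    ∀ {X Y : RightComodFg k A C} (j : X ⟶ Y),
      Function.Injective (RightComod.linearMap j.hom) →
        ∀ g : X.obj ⟶ M, ∃ h : Y.obj ⟶ M, j.hom ≫ h = g := by
  have hl := (LeftComod.comodLike (k := k) (A := A) hC.rightFlat).hasConcreteKernels_fg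
    hC.locallyNoetherian_left
  have hr := (RightComod.comodLike (k := k) (A := A) hC.leftFlat).hasConcreteKernels_fg
    hC.locallyNoetherian_right
  constructor
  · intro H X Y j hj g
    have : Mono j := (hr.mono_iff j).2 hj
    have hsurj := (hl.epi_iff (d.equiv.functor.map j.op)).1 inferInstance
    -- After identifying `X` with its double dual, `g` is an element of `M □_C X^*`; lifting it to
    -- `M □_C Y^*` gives the extension.
    obtain ⟨x, hx, hxg⟩ := d.exists_tensor hC hM ((d.doubleDual X).inv.hom ≫ g)
    obtain ⟨y, hy, rfl⟩ := H _ hsurj x hx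
    obtain ⟨f, hf⟩ := d.exists_hom hC hM hy
    rw [d.tensorToHom_map, ← hf] at hxg
    have h₁ : (d.doubleDual X).inv.hom ≫ g =
      (d.leftDualMap (d.equiv.functor.map j.op)).hom ≫ f := Subtype.ext hxg
    refine ⟨(d.doubleDual Y).hom.hom ≫ f, ?_⟩
    calc j.hom ≫ (d.doubleDual Y).hom.hom ≫ f
        = (j ≫ (d.doubleDual Y).hom).hom ≫ f := by simp
      _ = (d.doubleDual X).hom.hom ≫ (d.doubleDual X).inv.hom ≫ g := by
        rw [d.doubleDual_naturality, h₁]; simp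
      _ = g := by
        rw [← Category.assoc, ← ObjectProperty.FullSubcategory.comp_hom, Iso.hom_inv_id]
        exact Category.id_comp g
  · intro H N N' h hh x hx
    have : Epi h := (hl.epi_iff h).2 hh
    have hinj := (hr.mono_iff (d.leftDualMap h)).1 inferInstance
    obtain ⟨f, hf⟩ := d.exists_hom hC hM hx
    obtain ⟨f', rfl⟩ := H _ hinj f
    obtain ⟨y, hy, hyf⟩ := d.exists_tensor hC hM f'
    -- The extension `f'` yields `y`. Its image and `x` define the same morphism on the left dual of
    -- `N'`, so they agree by injectivity of the isomorphism.
    refine ⟨y, hy, (d.bijOn_tensorToHom hC hM N').injOn (omega_map_eq_zero _ hy) hx ?_⟩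
    rw [d.tensorToHom_map, ← hyf, ← hf]
    rfl

-- Two morphisms are identified by `M □_C -` exactly when their transposes agree after composition
-- with every morphism to `M`; the equivalence is faithful in both directions.
include d in
theorem cotensorEq_iff_separates (hC : HasDuality k A C) (hM : RightFlat k A M.carrier) :
    (∀ {N N' : LeftComodFg k A C} (f g : N ⟶ N'), CotensorEq M f.hom g.hom → f = g) ↔
    ∀ {X Y : RightComodFg k A C} (j j' : X ⟶ Y),
      (∀ g : Y.obj ⟶ M, j.hom ≫ g = j'.hom ≫ g) → j = j' := by
  have key : ∀ {N N' : LeftComodFg k A C} (f g : N ⟶ N'), CotensorEq M f.hom g.hom ↔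
      ∀ h : (d.leftDual N).obj ⟶ M, (d.leftDualMap f).hom ≫ h = (d.leftDualMap g).hom ≫ h := by
    intro N N' f g
    constructor
    · intro H h
      obtain ⟨x, hx, hxh⟩ := d.exists_tensor hC hM h
      have h₁ := congrArg (tensorToHom (d.dualLeft N').toLinearMap) (H x hx)
      rw [d.tensorToHom_map, d.tensorToHom_map, ← hxh] at h₁
      exact Subtype.ext h₁
    · intro H x hx
      obtain ⟨h, hxh⟩ := d.exists_hom hC hM hx
      refine (d.bijOn_tensorToHom hC hM N').injOn (omega_map_eq_zero _ hx)
        (omega_map_eq_zero _ hx) ?_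
      rw [d.tensorToHom_map, d.tensorToHom_map, ← hxh]
      exact congrArg RightComod.linearMap (H h)
  constructor
  · intro H X Y j j' hj
    refine Quiver.Hom.op_inj (d.equiv.functor.map_injective (H _ _ ((key _ _).2 fun h => ?_)))
    -- The double transpose is the original morphism conjugated by the double-dual isomorphisms.
    have e : ∀ i : X ⟶ Y, d.leftDualMap (d.equiv.functor.map i.op) =
        (d.doubleDual X).inv ≫ i ≫ (d.doubleDual Y).hom := fun i => by
      rw [d.doubleDual_naturality, Iso.inv_hom_id_assoc]
    rw [e, e]
    have := hj ((d.doubleDual Y).hom.hom ≫ h)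
    simp [this]
  · intro H N N' f g hfg
    exact d.equiv.inverse.map_injective (Quiver.Hom.unop_inj (H _ _ ((key f g).1 hfg)))

end Duality

end

end CoringTheory

end

/-! ### The two chains of equivalences -/

theorem proposition13 (k A C : Type u) [CommRing k] [Ring A] [Algebra k A]
    [AddCommGroup C] [Module k C] [Module A C] [Module Aᵐᵒᵖ C] [SMulCommClass A Aᵐᵒᵖ C]
    [IsScalarTower k A C] [IsScalarTower k Aᵐᵒᵖ C] [CoringTheory.Coring k A C]
    (hC : CoringTheory.HasDuality k A C)
    (M : CoringTheory.RightComod k A C) (hM : CoringTheory.RightFlat k A M.carrier) :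
    [CoringTheory.Coflat M,
      CoringTheory.IsExact (CoringTheory.homFg M),
      CategoryTheory.Injective M].TFAE ∧
    [CoringTheory.FaithfullyCoflat M,
      CoringTheory.IsFaithfullyExact (CoringTheory.homFg M),
      CategoryTheory.Injective M ∧ CategoryTheory.IsCoseparator M].TFAE := by
  open CoringTheory in
  obtain ⟨d⟩ := hC.duality
  have h₁ : Coflat M ↔ IsExact (homFg M) := by
    rw [coflat_iff hM hC.rightFlat,
      isExact_homFg_iff hC.leftFlat hC.locallyNoetherian_right,
      ← d.cotensorSurjective_iff_extends hC hM]
    exact ⟨fun H N N' g hg => H g.hom hg,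
      fun H N N' g hg => cotensorSurjective_of_fg hM hC.rightFlat hC.locallyNoetherian_left H g hg⟩
  have h₂ : IsExact (homFg M) ↔ Injective M :=
    isExact_homFg_iff_injective hC.leftFlat hC.locallyNoetherian_right
  have h₃ : (cotensor M).Faithful ↔ (homFg M).Faithful := by
    rw [cotensor_faithful_iff hM hC.rightFlat hC.locallyNoetherian_left, homFg_faithful_iff,
      d.cotensorEq_iff_separates hC hM]
  constructor
  · tfae_have 1 ↔ 2 := h₁
    tfae_have 2 ↔ 3 := h₂
    tfae_finish
  · tfae_have 1 ↔ 2 := and_congr h₁ h₃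
    tfae_have 2 ↔ 3 := by
      rw [IsFaithfullyExact, h₂]
      -- Faithfulness is compared with the cogenerator property only once `M` is known to be
      -- injective, since that comparison extends morphisms to `M`.
      exact and_congr_right fun h =>
        homFg_faithful_iff_isCoseparator hC.leftFlat hC.locallyNoetherian_right h
    tfae_finish
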